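/- **Theorem.** Let $M$ be a framed 3-manifold triangulated by $N$ tetrahedra: an oriented 3-manifold obtained from $N$ oriented truncated tetrahedra by gluing some of their hexagonal faces in pairs, by orientation-reversing maps, no face being glued to itself. The *small boundary* is tiled by the small triangles at the truncated vertices, the *big boundary* by the unglued hexagonal faces; they meet along circles, the *holes* of the big boundary. "Framed" means that every component of the small boundary is a disc, an annulus or a torus. Let $a$ and $t$ be the numbers of small annuli and small tori, and let $d=\sum_i(3g_i-3+h_i)$, summed over the components of the big boundary, of genus $g_i$ with $h_i$ holes; so $2d$ is the dimension of the phase space of the big boundary. An edge of the triangulation is *internal* if it lies on no unglued face. Let $\mathcal P_\times=\prod_{j=1}^N\{(z_j,z_j',z_j'')\in(\mathbb C^*)^3 : z_jz_j'z_j''=-1\}$. In the $j$-th tetrahedron opposite edges carry the same parameter, and $z_j,z_j',z_j''$ occur in the same cyclic order around all four vertices. For an internal edge $E_I$ let $c_I:\mathcal P_\times\to\mathbb C^*$ be the product of the parameters of all tetrahedron edges that are glued to $E_I$. Then: 1. There are exactly $N-d-a$ internal edges, and the maximal number of multiplicatively independent functions among the $c_I$ is exactly $r:=N-d-a-t$.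 2. There is one relation for each small torus, and there are no others: for a small torus $T$ let $m_T(I)\in\{0,1,2\}$ be the number of ends of $E_I$ on $T$. Then $\prod_I c_I^{m_T(I)}=1$ on $\mathcal P_\times$; the $t$ vectors $m_T$ are linearly independent; and for every $n$ with integer entries and $\prod_I c_I^{n_I}=1$, some nonzero integer multiple of $n$ is an integer combination of the vectors $m_T$. 3. (Logarithmic symplectic reduction.) Let $\widetilde{\mathcal P}_\times=\prod_j\{(Z_j,Z_j',Z_j'')\in\mathbb C^3: Z_j+Z_j'+Z_j''=i\pi\}$ with the symplectic form $\sum_j dZ_j\wedge dZ_j'$, and let $C_I=\sum(\text{parameters }Z_j,Z_j',Z_j''\text{ around }E_I)-2\pi i$. The level set $L=\{C_I=0\text{ for all }I\}$ is non-empty. The $C_I$ have constant Hamiltonian vector fields, which span a space $H$ of dimension $r$; translations by $H$ preserve $L$; and $H$ is exactly the radical of the symplectic form restricted to $L$. Hence the symplectic reduction $L/H$ of $\widetilde{\mathcal P}_\times$ by the $\mathbb C^r$-action generated by the $C_I$ is a symplectic affine space, and its dimension is $2d+2a+2t$, the dimension of the boundary phase space. -/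

import Mathlib

noncomputable section

/-- An oriented gluing of `N` tetrahedra along some of their faces.

Each tetrahedron has vertices `0, 1, 2, 3`, labelled compatibly with the orientation, and its face
number `i` is the face opposite to the vertex `i`. If `glue T i = none`, the face `i` of `T` is
unglued. If `glue T i = some (T', σ)`, it is glued to the face `σ i` of `T'`, each vertex `v ≠ i`
of the face going to the vertex `σ v`. A face is never glued to itself. Oddness of all the `σ`
says that the gluings reverse the induced orientations of the faces, so that the orientations of
the tetrahedra fit together.

Truncating all the vertices of the tetrahedra gives an oriented compact 3-manifold `M`. -/
structure TetGluing (N : ℕ) where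
  glue : Fin N → Fin 4 → Option (Fin N × Equiv.Perm (Fin 4))
  glue_symm : ∀ T i T' σ, glue T i = some (T', σ) → glue T' (σ i) = some (T, σ⁻¹)
  glue_ne_self : ∀ T i T' σ, glue T i = some (T', σ) → (T', σ i) ≠ (T, i)
  glue_odd : ∀ T i T' σ, glue T i = some (T', σ) → Equiv.Perm.sign σ = -1

/-- An edge of one of the `N` tetrahedra, before gluing. -/
abbrev TetEdge (N : ℕ) : Type := Fin N × {e : Sym2 (Fin 4) // ¬ e.IsDiag}

/-- An ordered pair of distinct vertices of one of the `N` tetrahedra, before gluing. A pair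
`(v, w)` in `T` is used in two ways:
* for the end, at the truncated vertex `v`, of the edge `vw` of `T`; this is a vertex of the small
  triangle at `v`;
* for the side, lying in the face `w`, of the small triangle at `v`. -/
abbrev TetPair (N : ℕ) : Type := Fin N × {p : Fin 4 × Fin 4 // p.1 ≠ p.2}

namespace TetGluing

variable {N : ℕ} (G : TetGluing N)

/-! ### The edges of the triangulation -/

/-- A face gluing identifies the tetrahedron edges `x` and `y`. -/
def EdgeRel (x y : TetEdge N) : Prop :=
  ∃ i σ, G.glue x.1 i = some (y.1, σ) ∧ i ∉ x.2.1 ∧ y.2.1 = Sym2.map σ x.2.1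

/-- The edges of the triangulation: classes of identified tetrahedron edges (`Quot` is the quotient
by the equivalence relation that is generated by the relation). -/
def Edge : Type := Quot G.EdgeRel

/-- The edge of the triangulation that a tetrahedron edge becomes. -/
def edge (x : TetEdge N) : G.Edge := Quot.mk _ x

/-- An edge is external if it lies on some unglued face. -/
def IsExternal (E : G.Edge) : Prop :=
  ∃ (x : TetEdge N) (i : Fin 4), G.edge x = E ∧ i ∉ x.2.1 ∧ G.glue x.1 i = none

/-- The internal edges of the triangulation. -/
def InternalEdge : Type := {E : G.Edge // ¬ G.IsExternal E}

instance : Finite G.Edge := inferInstanceAs (Finite (Quot G.EdgeRel))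

instance : Finite G.InternalEdge := inferInstanceAs (Finite {E : G.Edge // ¬ G.IsExternal E})

instance : Fintype G.InternalEdge := Fintype.ofFinite _

/-! ### The small boundary

It is the surface tiled by the `4 N` small triangles at the truncated vertices. -/

/-- A face gluing joins the small triangles `x` and `y` along a side. -/
def SmallRel (x y : Fin N × Fin 4) : Prop :=
  ∃ i σ, G.glue x.1 i = some (y.1, σ) ∧ i ≠ x.2 ∧ y.2 = σ x.2

/-- The connected components of the small boundary. -/
def SmallComp : Type := Quot G.SmallRel

/-- The component of the small boundary that contains the small triangle at the vertex `v`
of `T`. -/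
def smallComp (T : Fin N) (v : Fin 4) : G.SmallComp := Quot.mk _ (T, v)

/-- A face gluing identifies the edge ends `x` and `y`. -/
def EndRel (x y : TetPair N) : Prop :=
  ∃ i σ, G.glue x.1 i = some (y.1, σ) ∧ i ≠ x.2.1.1 ∧ i ≠ x.2.1.2 ∧
    y.2.1 = (σ x.2.1.1, σ x.2.1.2)

/-- The vertices of the small boundary, which are the ends of the edges of the triangulation. -/
def SmallVertex : Type := Quot G.EndRel

/-- The vertex of the small boundary that an edge end becomes. -/
def smallVertex (x : TetPair N) : G.SmallVertex := Quot.mk _ x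

/-- A face gluing identifies the sides `x` and `y` of small triangles. -/
def SideRel (x y : TetPair N) : Prop :=
  ∃ σ, G.glue x.1 x.2.1.2 = some (y.1, σ) ∧ y.2.1 = (σ x.2.1.1, σ x.2.1.2)

/-- The edges (sides of small triangles) of the small boundary. -/
def SmallSide : Type := Quot G.SideRel

/-- The edge of the small boundary that a side of a small triangle becomes. -/
def smallSide (x : TetPair N) : G.SmallSide := Quot.mk _ x

/-- The Euler characteristic of a component of the small boundary. -/
def smallEuler (s : G.SmallComp) : ℤ :=
  (Nat.card {V : G.SmallVertex // ∃ x, G.smallVertex x = V ∧ G.smallComp x.1 x.2.1.1 = s} : ℤ)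
    - Nat.card {S : G.SmallSide // ∃ x, G.smallSide x = S ∧ G.smallComp x.1 x.2.1.1 = s}
    + Nat.card {x : Fin N × Fin 4 // G.smallComp x.1 x.2 = s}

/-- The arcs along which the small boundary meets the big boundary: the sides of small triangles
that lie in unglued faces. -/
def Arc : Type := {x : TetPair N // G.glue x.1 x.2.1.2 = none}

/-- The vertex `V` of the small boundary is an endpoint of the arc `A`. -/
def ArcEndpoint (A : G.Arc) (V : G.SmallVertex) : Prop :=
  ∃ x : TetPair N, G.smallVertex x = V ∧ x.1 = A.1.1 ∧ x.2.1.1 = A.1.2.1.1 ∧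
    x.2.1.2 ≠ A.1.2.1.2

/-- The circles along which the small boundary meets the big boundary (the boundary circles of the
small boundary, and the holes of the big boundary): classes of arcs, where arcs that share an
endpoint are identified. -/
def Circle : Type := Quot fun A B : G.Arc ↦ ∃ V, G.ArcEndpoint A V ∧ G.ArcEndpoint B V

/-- The circle that contains an arc. -/
def circle (A : G.Arc) : G.Circle := Quot.mk _ A

/-- The number of boundary circles of a component of the small boundary. -/
def smallCircles (s : G.SmallComp) : ℕ :=
  Nat.card {c : G.Circle // ∃ A, G.circle A = c ∧ G.smallComp A.1.1 A.1.2.1.1 = s}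

/-- A small disc. The components of the small boundary are connected compact oriented surfaces, so
that the Euler characteristic and the number of boundary circles determine their topology. -/
def IsDisc (s : G.SmallComp) : Prop := G.smallEuler s = 1 ∧ G.smallCircles s = 1

/-- A small annulus. -/
def IsAnnulus (s : G.SmallComp) : Prop := G.smallEuler s = 0 ∧ G.smallCircles s = 2

/-- A small torus. -/
def IsTorus (s : G.SmallComp) : Prop := G.smallEuler s = 0 ∧ G.smallCircles s = 0

/-- The gluing is a triangulated framed 3-manifold: all components of the small boundary are discs,
annuli or tori. -/
def IsFramed : Prop := ∀ s, G.IsDisc s ∨ G.IsAnnulus s ∨ G.IsTorus s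

/-- The number `a` of small annuli. -/
def numAnnuli : ℕ := Nat.card {s // G.IsAnnulus s}

/-- The number `t` of small tori. -/
def numTori : ℕ := Nat.card {s // G.IsTorus s}

/-! ### The big boundary

It is the surface tiled by the unglued faces, with the circles as holes. -/

/-- The unglued faces. -/
def BigFace : Type := {f : Fin N × Fin 4 // G.glue f.1 f.2 = none}

/-- The (external) edge `E` is a side of the unglued face `f`. -/
def BigFaceSide (f : G.BigFace) (E : G.Edge) : Prop :=
  ∃ x : TetEdge N, G.edge x = E ∧ x.1 = f.1.1 ∧ f.1.2 ∉ x.2.1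

/-- The connected components of the big boundary: unglued faces that share an edge are in the same
component. -/
def BigComp : Type := Quot fun f g : G.BigFace ↦ ∃ E, G.BigFaceSide f E ∧ G.BigFaceSide g E

/-- The component of the big boundary that contains an unglued face. -/
def bigComp (f : G.BigFace) : G.BigComp := Quot.mk _ f

instance : Finite G.BigComp :=
  haveI : Finite G.BigFace := inferInstanceAs (Finite {f : Fin N × Fin 4 // G.glue f.1 f.2 = none})
  inferInstanceAs (Finite (Quot _))

instance : Fintype G.BigComp := Fintype.ofFinite _

/-- The number of holes of a component of the big boundary. -/
def bigHoles (C : G.BigComp) : ℕ :=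
  Nat.card {c : G.Circle // ∃ A : G.Arc, G.circle A = c ∧
    G.bigComp ⟨(A.1.1, A.1.2.1.2), A.2⟩ = C}

/-- The genus `g` of a component of the big boundary. Filling each hole with a point gives a closed
oriented surface that is triangulated with the holes as vertices, so that
`2 - 2 g = #holes - #edges + #triangles`. -/
def bigGenus (C : G.BigComp) : ℚ :=
  (2 - ((G.bigHoles C : ℚ)
    - Nat.card {E : G.Edge // ∃ f, G.bigComp f = C ∧ G.BigFaceSide f E}
    + Nat.card {f : G.BigFace // G.bigComp f = C})) / 2

/-- Half of the dimension `2 d` of the phase space of the big boundary: a component of genus `g`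
with `h` holes contributes `3 g - 3 + h` to `d`. -/
def bigHalfDim : ℚ := ∑ C, (3 * G.bigGenus C - 3 + G.bigHoles C)

/-! ### The tetrahedron phase spaces and the gluing functions -/

end TetGluing

/-- The index of the edge parameter carried by an edge of a tetrahedron: `0`, `1`, `2` for
`z`, `z'`, `z''`. Opposite edges carry the same parameter, and `z`, `z'`, `z''` occur in the same
cyclic order around each of the four vertices. -/
def edgeParam (e : {e : Sym2 (Fin 4) // ¬ e.IsDiag}) : Fin 3 :=
  if e.1 = s(0, 1) ∨ e.1 = s(2, 3) then 0
  else if e.1 = s(0, 2) ∨ e.1 = s(1, 3) then 1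
  else 2

/-- The product of the tetrahedron phase spaces `{(z, z', z'') ∈ (ℂˣ)³ | z z' z'' = -1}`. -/
def PhaseSpace (N : ℕ) : Type := {z : Fin N → Fin 3 → ℂˣ // ∀ T, z T 0 * z T 1 * z T 2 = -1}

/-- The product of the logarithmic tetrahedron phase spaces
`{(Z, Z', Z'') ∈ ℂ³ | Z + Z' + Z'' = iπ}`. -/
def logPhaseSpace (N : ℕ) : Set (Fin N → Fin 3 → ℂ) :=
  {Z | ∀ T, Z T 0 + Z T 1 + Z T 2 = Complex.I * Real.pi}

/-- The tangent space of the affine space `logPhaseSpace N`. -/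
def logTangent (N : ℕ) : Submodule ℂ (Fin N → Fin 3 → ℂ) where
  carrier := {u | ∀ T, u T 0 + u T 1 + u T 2 = 0}
  zero_mem' := by simp
  add_mem' := by
    intro u v hu hv T
    have h1 := hu T
    have h2 := hv T
    simp only [Pi.add_apply]
    linear_combination h1 + h2
  smul_mem' := by
    intro c u hu T
    have h1 := hu T
    simp only [Pi.smul_apply, smul_eq_mul]
    linear_combination c * h1

/-- The symplectic form `∑ dZ ∧ dZ'`, summed over the tetrahedra, evaluated on tangent vectors. -/
def logSymplectic {N : ℕ} (u v : Fin N → Fin 3 → ℂ) : ℂ :=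
  ∑ T, (u T 0 * v T 1 - u T 1 * v T 0)

namespace TetGluing

variable {N : ℕ} (G : TetGluing N)

open Classical in
/-- The tetrahedron edges that are glued together to the internal edge `I`. -/
def around (I : G.InternalEdge) : Finset (TetEdge N) :=
  Finset.univ.filter fun x ↦ G.edge x = I.1

/-- The gluing function `c_I` on the product phase space: the product of the edge parameters around
the internal edge `I`. -/
def gluingFun (I : G.InternalEdge) (z : PhaseSpace N) : ℂˣ :=
  ∏ x ∈ G.around I, z.1 x.1 (edgeParam x.2)

/-- The linear part of the logarithmic gluing function `C_I`. -/
def gluingSum (I : G.InternalEdge) (Z : Fin N → Fin 3 → ℂ) : ℂ :=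
  ∑ x ∈ G.around I, Z x.1 (edgeParam x.2)

/-- The logarithmic gluing function `C_I`. -/
def logGluingFun (I : G.InternalEdge) (Z : Fin N → Fin 3 → ℂ) : ℂ :=
  G.gluingSum I Z - 2 * Real.pi * Complex.I

/-- The gluing functions `c_I`, for `I` in `S`, are multiplicatively independent: the only product
of integer powers of them that is the constant function `1` is the one with zero exponents. -/
def MulIndep (S : Finset G.InternalEdge) : Prop :=
  ∀ n : G.InternalEdge → ℤ, (∀ z, ∏ I ∈ S, G.gluingFun I z ^ n I = 1) → ∀ I ∈ S, n I = 0

/-- `n` is the exponent vector of a multiplicative relation `∏ c_I ^ n_I = 1` among all the gluing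
functions. -/
def IsRelation (n : G.InternalEdge → ℤ) : Prop :=
  ∀ z, ∏ I, G.gluingFun I z ^ n I = 1

/-- The number of ends (`0`, `1` or `2`) of the internal edge `I` that lie on the component `s` of
the small boundary. -/
def endsAt (s : G.SmallComp) (I : G.InternalEdge) : ℤ :=
  Nat.card {V : G.SmallVertex // ∃ x : TetPair N, G.smallVertex x = V ∧
    G.smallComp x.1 x.2.1.1 = s ∧
    G.edge (x.1, ⟨s(x.2.1.1, x.2.1.2), fun h ↦ x.2.2 (Sym2.mk_isDiag_iff.1 h)⟩) = I.1}

/-- The tangent space of the level set `C_I = 0` (for all `I`) in `logPhaseSpace N`. -/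
def levelTangent : Submodule ℂ (Fin N → Fin 3 → ℂ) where
  carrier := {u | u ∈ logTangent N ∧ ∀ I, G.gluingSum I u = 0}
  zero_mem' := ⟨zero_mem _, fun I ↦ by simp [gluingSum]⟩
  add_mem' := by
    intro u v hu hv
    refine ⟨add_mem hu.1 hv.1, fun I ↦ ?_⟩
    have h1 := hu.2 I
    have h2 := hv.2 I
    simp only [gluingSum, Pi.add_apply, Finset.sum_add_distrib] at h1 h2 ⊢
    rw [h1, h2, add_zero]
  smul_mem' := by
    intro c u hu
    refine ⟨Submodule.smul_mem _ c hu.1, fun I ↦ ?_⟩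
    have h1 := hu.2 I
    simp only [gluingSum, Pi.smul_apply, smul_eq_mul, ← Finset.mul_sum] at h1 ⊢
    rw [h1, mul_zero]

/-- `X` is the (constant) Hamiltonian vector field of `C_I` on `logPhaseSpace N`. -/
def IsHamiltonian (I : G.InternalEdge) (X : Fin N → Fin 3 → ℂ) : Prop :=
  X ∈ logTangent N ∧ ∀ v ∈ logTangent N, logSymplectic X v = G.gluingSum I v

/-- The group of translations of `logPhaseSpace N` that is generated by the Hamiltonian flows of
the `C_I`. -/
def hamiltonianSpan : Submodule ℂ (Fin N → Fin 3 → ℂ) :=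
  Submodule.span ℂ {X | ∃ I, G.IsHamiltonian I X}

end TetGluing

end

noncomputable section

/-! Everything reduces to one integer linear map, `hamMap`, sending an exponent vector $n$ to the
Hamiltonian vector field of $\sum_I n_I C_I$.

The edge count is an Euler characteristic computation. Orientation prevents an edge from being
identified with its own reverse (`smallVertex_rev_ne`), so the small boundary has exactly two
vertices per edge. It also has $4N$ triangles, and its sides are counted by incidence. Framing
evaluates the total Euler characteristic as the number of circles minus $2a$; together with
$2\cdot\#\text{external edges}=3\cdot\#\text{unglued faces}$ this gives `natCard_internalEdge`.

The kernel is found as follows. The field of $n$, extended by zero to external edges, vanishes iff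
in each tetrahedron the three sums of $n$ over opposite edges agree (`Balanced`). Then
$2n(vw)=f(v)+f(w)$ for a function $f$ of the corners, and $f(v)$ can be read off any face through
$v$ (`cornerVal_eq`). Hence $f$ is constant on components of the small boundary, and zero on those
that meet an unglued face. Only tori remain, so the kernel is spanned by the independent vectors
$m_T$ (`ker_hamMap`), and the rank is $r$ over any field of characteristic zero.

Multiplicative relations are governed by the same condition: absolute values at test points show
that relations are balanced (`balanced_of_isRelation`), and a balanced $n$ makes $\prod c_I^{n_I}$ a
sign. For $m_T$ the exponent of $-1$ is the number of triangles of the torus, which is twice its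
number of vertices. The same identity makes the inhomogeneous equations $C_I=0$ consistent.

Finally, $H$ is isotropic: the bracket of two gluing functions is a sum of face terms that cancel
across each gluing (`sum_oppSum_mul_eq_zero`). The tangent space of $L$ is $H^\perp$, so its radical
is $H^\perp\cap H^{\perp\perp}=H$ and the quotient has dimension $2N-2r$. -/

/-- The vertex `u` such that `(v, w, u, x)` is an even permutation of `(0, 1, 2, 3)`. -/
def evenThird : Fin 4 → Fin 4 → Fin 4 :=
  ![![0, 2, 3, 1], ![3, 0, 0, 2], ![1, 3, 0, 0], ![2, 0, 1, 0]]

theorem evenThird_ne_left : ∀ v w : Fin 4, v ≠ w → evenThird v w ≠ v := by decide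

theorem evenThird_ne_right : ∀ v w : Fin 4, v ≠ w → evenThird v w ≠ w := by decide

theorem eq_evenThird_or : ∀ v w i : Fin 4, v ≠ w → i ≠ v → i ≠ w →
    i = evenThird v w ∨ i = evenThird w v := by decide

-- An odd permutation reverses the cyclic order around every edge; hence the swap of `v` and `w` on
-- the right.
set_option maxRecDepth 100000 in
theorem evenThird_map : ∀ (σ : Equiv.Perm (Fin 4)), Equiv.Perm.sign σ = -1 → ∀ v w : Fin 4, v ≠ w →
    evenThird (σ v) (σ w) = σ (evenThird w v) := by decide

/-! ### Ends of the edges of single tetrahedra. -/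

/-- The same tetrahedron edge, seen from its other end. -/
def TetPair.rev {N : ℕ} (p : TetPair N) : TetPair N :=
  (p.1, ⟨(p.2.1.2, p.2.1.1), p.2.2.symm⟩)

@[simp] theorem TetPair.rev_rev {N : ℕ} (p : TetPair N) : p.rev.rev = p := rfl

theorem TetPair.rev_ne {N : ℕ} (p : TetPair N) : p.rev ≠ p := by
  intro h
  have := congrArg (fun q : TetPair N ↦ q.2.1.1) h
  exact p.2.2 this.symm

theorem TetPair.rev_injective {N : ℕ} : Function.Injective (TetPair.rev (N := N)) :=
  fun p q h ↦ by rw [← p.rev_rev, h, q.rev_rev]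

theorem TetPair.ext' {N : ℕ} {p q : TetPair N} (h1 : p.1 = q.1) (h2 : p.2.1 = q.2.1) : p = q :=
  Prod.ext h1 (Subtype.ext h2)

/-- The tetrahedron edge that has the given end. -/
def TetPair.toEdge {N : ℕ} (p : TetPair N) : TetEdge N :=
  (p.1, ⟨s(p.2.1.1, p.2.1.2), fun h ↦ p.2.2 (Sym2.mk_isDiag_iff.1 h)⟩)

theorem TetPair.toEdge_rev {N : ℕ} (p : TetPair N) : p.rev.toEdge = p.toEdge :=
  Prod.ext rfl (Subtype.ext Sym2.eq_swap)

theorem TetPair.toEdge_surjective {N : ℕ} (x : TetEdge N) : ∃ p : TetPair N, p.toEdge = x := by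
  obtain ⟨T, e, he⟩ := x
  induction e with
  | _ v w => exact ⟨(T, ⟨(v, w), fun h ↦ he (Sym2.mk_isDiag_iff.2 h)⟩), rfl⟩

theorem TetPair.toEdge_eq {N : ℕ} {p q : TetPair N} (h : p.toEdge = q.toEdge) :
    p = q ∨ p = q.rev := by
  have h1 : p.1 = q.1 := congrArg (fun x : TetEdge N ↦ x.1) h
  have h2 : s(p.2.1.1, p.2.1.2) = s(q.2.1.1, q.2.1.2) :=
    congrArg (fun x : TetEdge N ↦ x.2.1) h
  rcases Sym2.eq_iff.1 h2 with ⟨h3, h4⟩ | ⟨h3, h4⟩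
  · exact Or.inl (TetPair.ext' h1 (Prod.ext h3 h4))
  · exact Or.inr (TetPair.ext' h1 (Prod.ext h3 h4))

namespace TetGluing

variable {N : ℕ} (G : TetGluing N)

/-! ### Turning around an edge -/

/-- Seen from the edge end `p`, the face through which one leaves a tetrahedron when turning around
the edge in the positive direction. -/
abbrev exitFace (p : TetPair N) : Fin 4 := evenThird p.2.1.1 p.2.1.2

/-- Crossing the exit face leads from the edge end `p` to the edge end `q`. -/
def Next (p q : TetPair N) : Prop :=
  ∃ σ, G.glue p.1 (exitFace p) = some (q.1, σ) ∧ q.2.1 = (σ p.2.1.1, σ p.2.1.2)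

variable {G}

theorem Next.right_unique {p q q' : TetPair N} (h : G.Next p q) (h' : G.Next p q') : q = q' := by
  obtain ⟨σ, h1, h2⟩ := h
  obtain ⟨τ, h3, h4⟩ := h'
  rw [h1, Option.some.injEq, Prod.mk.injEq] at h3
  obtain ⟨h5, rfl⟩ := h3
  exact TetPair.ext' h5 (h2.trans h4.symm)

/-- Seen from the other end the rotation runs backwards: the exit face of `q.rev` is the face just
crossed. -/
theorem Next.rev {p q : TetPair N} (h : G.Next p q) : G.Next q.rev p.rev := by
  obtain ⟨σ, h1, h2⟩ := h
  refine ⟨σ⁻¹, ?_, ?_⟩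
  · have h3 : exitFace q.rev = σ (exitFace p) := by
      simp only [exitFace, TetPair.rev, h2]
      exact evenThird_map σ (G.glue_odd _ _ _ _ h1) _ _ p.2.2.symm
    rw [h3]
    exact G.glue_symm _ _ _ _ h1
  · simp [TetPair.rev, h2]

theorem Next.left_unique {p p' q : TetPair N} (h : G.Next p q) (h' : G.Next p' q) : p = p' :=
  TetPair.rev_injective (h.rev.right_unique h'.rev)

/-- By `evenThird_map`, such a step would glue the exit face of `p` to itself. -/
theorem not_next_rev (p : TetPair N) : ¬ G.Next p p.rev := by
  rintro ⟨σ, h1, h2⟩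
  have h3 := evenThird_map σ (G.glue_odd _ _ _ _ h1) _ _ p.2.2.symm
  simp only [TetPair.rev, Prod.mk.injEq] at h2
  rw [← h2.1, ← h2.2] at h3
  exact G.glue_ne_self _ _ _ _ h1 (Prod.ext rfl h3.symm)

theorem exists_next_or (p : TetPair N) :
    (∃ q, G.Next p q) ∨ G.glue p.1 (exitFace p) = none := by
  rcases h : G.glue p.1 (exitFace p) with _ | ⟨T, σ⟩
  · exact Or.inr rfl
  · exact Or.inl ⟨(T, ⟨(σ p.2.1.1, σ p.2.1.2), fun h ↦ p.2.2 (σ.injective h)⟩), σ, h, rfl⟩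

theorem not_next_of_eq_none {p q : TetPair N} (h : G.glue p.1 (exitFace p) = none) :
    ¬ G.Next p q := by
  rintro ⟨σ, h1, -⟩
  simp [h] at h1

theorem Next.endRel {p q : TetPair N} (h : G.Next p q) : G.EndRel p q := by
  obtain ⟨σ, h1, h2⟩ := h
  exact ⟨_, σ, h1, evenThird_ne_left _ _ p.2.2, evenThird_ne_right _ _ p.2.2, h2⟩

theorem EndRel.next_or {p q : TetPair N} (h : G.EndRel p q) : G.Next p q ∨ G.Next q p := by
  obtain ⟨i, σ, h1, h2, h3, h4⟩ := h
  rcases eq_evenThird_or _ _ i p.2.2 h2 h3 with rfl | rfl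
  · exact Or.inl ⟨σ, h1, h4⟩
  · right
    have : G.Next p.rev q.rev := ⟨σ, h1, by simp [TetPair.rev, h4]⟩
    exact this.rev

theorem endRel_rev {p q : TetPair N} (h : G.EndRel p q) : G.EndRel p.rev q.rev := by
  obtain ⟨i, σ, h1, h2, h3, h4⟩ := h
  exact ⟨i, σ, h1, h3, h2, by simp [TetPair.rev, h4]⟩

open Relation in
theorem reflTransGen_next_rev {p q : TetPair N} (h : ReflTransGen G.Next p q) :
    ReflTransGen G.Next q.rev p.rev := by
  induction h with
  | refl => exact .refl
  | tail _ h ih => exact .head h.rev ih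

-- `Next` and its converse are both partial functions, so every zigzag of identifications
-- straightens to a one-way chain.
variable (G) in
open Relation in
theorem smallVertex_eq_iff {p q : TetPair N} : G.smallVertex p = G.smallVertex q ↔
    ReflTransGen G.Next p q ∨ ReflTransGen G.Next q p := by
  constructor
  · intro h
    replace h := Quot.eqvGen_exact h
    induction h with
    | rel _ _ h => exact h.next_or.imp .single .single
    | refl => exact Or.inl .refl
    | symm _ _ _ ih => exact ih.symm
    | trans a b c _ _ ih1 ih2 =>
      rcases ih1 with ih1 | ih1 <;> rcases ih2 with ih2 | ih2
      · exact Or.inl (ih1.trans ih2)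
      · have hU : Relator.RightUnique G.Next := fun _ _ _ ↦ Next.right_unique
        rcases ReflTransGen.total_of_right_unique hU (reflTransGen_next_rev ih1)
          (reflTransGen_next_rev ih2) with h | h
        · exact Or.inr (reflTransGen_next_rev h)
        · exact Or.inl (reflTransGen_next_rev h)
      · exact ReflTransGen.total_of_right_unique (fun _ _ _ ↦ Next.right_unique) ih1 ih2
      · exact Or.inr (ih2.trans ih1)
  · have key : ∀ a b : TetPair N, ReflTransGen G.Next a b → G.smallVertex a = G.smallVertex b := by
      intro a b h
      induction h with
      | refl => rfl
      | tail _ h ih => exact ih.trans (Quot.sound h.endRel)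
    rintro (h | h)
    · exact key _ _ h
    · exact (key _ _ h).symm

/-- The last step of a chain from `p` to `p.rev` mirrors the first. Removing both leaves a chain
from `f 1` to `(f 1).rev`, shorter by two, until zero or one step remains; both are impossible. -/
theorem not_iterate_next_rev (k : ℕ) : ∀ (p : TetPair N) (f : ℕ → TetPair N), f 0 = p →
    f k = p.rev → (∀ i < k, G.Next (f i) (f (i + 1))) → False := by
  induction k using Nat.strong_induction_on with
  | _ k ih =>
    intro p f h0 hk hf
    match k with
    | 0 => exact p.rev_ne (hk.symm.trans h0)
    | 1 =>
      have := hf 0 one_pos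
      rw [h0, zero_add, hk] at this
      exact not_next_rev p this
    | k + 2 =>
      have h1 := hf 0 (by omega)
      have h2 := hf (k + 1) (by omega)
      rw [h0] at h1
      rw [hk] at h2
      refine ih k (by omega) (f 1) (fun i ↦ f (i + 1)) rfl (h2.left_unique h1.rev) ?_
      exact fun i hi ↦ hf (i + 1) (by omega)

/-- The two ends of an edge are distinct vertices of the small boundary. This is where orientability
enters the counting. -/
theorem smallVertex_rev_ne (p : TetPair N) : G.smallVertex p.rev ≠ G.smallVertex p := by
  have key : ∀ q, ¬ Relation.ReflTransGen G.Next q q.rev := by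
    intro q h
    obtain ⟨k, f, h0, hk, hf⟩ : ∃ (k : ℕ) (f : ℕ → TetPair N), f 0 = q ∧ f k = q.rev ∧
        ∀ i < k, G.Next (f i) (f (i + 1)) := by
      generalize q.rev = r at h
      induction h with
      | refl => exact ⟨0, fun _ ↦ q, rfl, rfl, by simp⟩
      | @tail b c _ h ih =>
        obtain ⟨k, f, h0, hk, hf⟩ := ih
        refine ⟨k + 1, fun i ↦ if i ≤ k then f i else c, by simp [h0], by simp, ?_⟩
        intro i hi
        rcases Nat.lt_succ_iff_lt_or_eq.1 hi with hi | rfl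
        · simpa [hi.le, Nat.succ_le_of_lt hi] using hf i hi
        · simpa [hk] using h
    exact not_iterate_next_rev k q f h0 hk hf
  intro h
  rcases G.smallVertex_eq_iff.1 h with h | h
  · exact key p.rev h
  · exact key p h

/-! ### Edges and their ends -/

variable (G) in
/-- The edge of the triangulation that has a given end. -/
def edgeOf (p : TetPair N) : G.Edge := G.edge p.toEdge

theorem edgeOf_rev (p : TetPair N) : G.edgeOf p.rev = G.edgeOf p := by
  rw [edgeOf, edgeOf, p.toEdge_rev]

theorem edgeOf_eq_of_endRel {p q : TetPair N} (h : G.EndRel p q) : G.edgeOf p = G.edgeOf q := by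
  obtain ⟨i, σ, h1, h2, h3, h4⟩ := h
  refine Quot.sound ⟨i, σ, h1, ?_, ?_⟩
  · simp [TetPair.toEdge, h2, h3]
  · simp [TetPair.toEdge, h4]

theorem edgeOf_surjective (E : G.Edge) : ∃ p, G.edgeOf p = E := by
  obtain ⟨x, rfl⟩ := Quot.exists_rep E
  obtain ⟨p, rfl⟩ := TetPair.toEdge_surjective x
  exact ⟨p, rfl⟩

theorem smallVertex_rev_eq {p q : TetPair N} (h : G.smallVertex p = G.smallVertex q) :
    G.smallVertex p.rev = G.smallVertex q.rev := by
  have := congrArg (Quot.map (rb := G.EndRel) TetPair.rev (fun _ _ ↦ endRel_rev)) h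
  exact this

theorem edgeOf_eq_iff {p q : TetPair N} : G.edgeOf p = G.edgeOf q ↔
    G.smallVertex p = G.smallVertex q ∨ G.smallVertex p = G.smallVertex q.rev := by
  constructor
  · intro h
    replace h := Quot.eqvGen_exact h
    have same : ∀ p q : TetPair N, p.toEdge = q.toEdge →
        G.smallVertex p = G.smallVertex q ∨ G.smallVertex p = G.smallVertex q.rev := by
      intro p q h
      rcases TetPair.toEdge_eq h with rfl | rfl
      · exact Or.inl rfl
      · exact Or.inr rfl
    generalize hx : p.toEdge = x at h
    generalize hy : q.toEdge = y at h
    induction h generalizing p q with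
    | rel x y h =>
      subst hx hy
      obtain ⟨i, σ, h1, h2, h3⟩ := h
      have h4 : G.EndRel p (q.1, ⟨(σ p.2.1.1, σ p.2.1.2), fun h ↦ p.2.2 (σ.injective h)⟩) := by
        simp only [TetPair.toEdge, Sym2.mem_iff, not_or] at h2
        exact ⟨i, σ, h1, h2.1, h2.2, rfl⟩
      have h5 : G.smallVertex p = _ := Quot.sound h4
      rw [h5]
      exact same _ _ (Prod.ext rfl (Subtype.ext h3.symm))
    | refl x => exact same _ _ (hx.trans hy.symm)
    | symm x y _ ih =>
      rcases ih hy hx with h | h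
      · exact Or.inl h.symm
      · exact Or.inr (smallVertex_rev_eq h).symm
    | trans x y z _ _ ih1 ih2 =>
      obtain ⟨r, hr⟩ := TetPair.toEdge_surjective y
      rcases ih1 hx hr with h | h <;> rcases ih2 hr hy with h' | h'
      · exact Or.inl (h.trans h')
      · exact Or.inr (h.trans h')
      · exact Or.inr (h.trans (smallVertex_rev_eq h'))
      · exact Or.inl (h.trans (smallVertex_rev_eq h'))
  · have key : ∀ p q : TetPair N, G.smallVertex p = G.smallVertex q → G.edgeOf p = G.edgeOf q := by
      intro p q h
      replace h := Quot.eqvGen_exact h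
      induction h with
      | rel _ _ h => exact edgeOf_eq_of_endRel h
      | refl => rfl
      | symm _ _ _ ih => exact ih.symm
      | trans _ _ _ _ _ ih1 ih2 => exact ih1.trans ih2
    rintro (h | h)
    · exact key _ _ h
    · rw [key _ _ h, edgeOf_rev]

variable (G) in
/-- The edge of the triangulation that has a given vertex of the small boundary as an end. -/
def vertexEdge : G.SmallVertex → G.Edge := Quot.lift G.edgeOf fun _ _ ↦ edgeOf_eq_of_endRel

@[simp] theorem vertexEdge_smallVertex (p : TetPair N) :
    G.vertexEdge (G.smallVertex p) = G.edgeOf p := rfl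

variable (G) in
/-- The component of the small boundary that contains a vertex. -/
def vertexComp : G.SmallVertex → G.SmallComp :=
  Quot.lift (fun p ↦ G.smallComp p.1 p.2.1.1) (by
    rintro p q ⟨i, σ, h1, h2, h3, h4⟩
    exact Quot.sound ⟨i, σ, h1, h2, by simp [h4]⟩)

@[simp] theorem vertexComp_smallVertex (p : TetPair N) :
    G.vertexComp (G.smallVertex p) = G.smallComp p.1 p.2.1.1 := rfl

theorem vertexEdge_eq_edgeOf_iff (V : G.SmallVertex) (p : TetPair N) :
    G.vertexEdge V = G.edgeOf p ↔ V = G.smallVertex p ∨ V = G.smallVertex p.rev := by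
  obtain ⟨q, rfl⟩ := Quot.exists_rep V
  exact edgeOf_eq_iff

/-! ### External edges -/

theorem isExternal_iff (E : G.Edge) :
    G.IsExternal E ↔ ∃ p, G.edgeOf p = E ∧ G.glue p.1 (exitFace p) = none := by
  constructor
  · rintro ⟨x, i, rfl, hi, h⟩
    obtain ⟨p, rfl⟩ := TetPair.toEdge_surjective x
    simp only [TetPair.toEdge, Sym2.mem_iff, not_or] at hi
    rcases eq_evenThird_or _ _ i p.2.2 hi.1 hi.2 with rfl | rfl
    · exact ⟨p, rfl, h⟩
    · exact ⟨p.rev, edgeOf_rev p, h⟩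
  · rintro ⟨p, rfl, h⟩
    refine ⟨p.toEdge, _, rfl, ?_, h⟩
    simp [TetPair.toEdge, evenThird_ne_left _ _ p.2.2, evenThird_ne_right _ _ p.2.2]

-- Otherwise `Next` would be an injective self-map of the finite set reachable from `p`, hence
-- surjective, although nothing precedes `p`.
open Relation in
theorem exists_terminal {p : TetPair N} (hp : ∀ q, ¬ G.Next q p) :
    ∃ q, ReflTransGen G.Next p q ∧ G.glue q.1 (exitFace q) = none := by
  by_contra! h
  have h1 : ∀ q : {q // ReflTransGen G.Next p q}, ∃ r : {q // ReflTransGen G.Next p q},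
      G.Next q.1 r.1 := by
    rintro ⟨q, hq⟩
    rcases exists_next_or (G := G) q with ⟨r, hr⟩ | h'
    · exact ⟨⟨r, hq.tail hr⟩, hr⟩
    · exact absurd h' (h q hq)
  choose f hf using h1
  have hinj : Function.Injective f := by
    intro a b hab
    have := hf b
    rw [← hab] at this
    exact Subtype.ext ((hf a).left_unique this)
  obtain ⟨q, hq⟩ := Finite.injective_iff_surjective.1 hinj ⟨p, .refl⟩
  have := hf q
  rw [hq] at this
  exact hp _ this

/-- Each vertex of the small boundary that is the end of an external edge contains exactly one
edge end whose exit face is unglued. -/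
theorem bijective_terminal : Function.Bijective
    (fun p : {p : TetPair N // G.glue p.1 (exitFace p) = none} ↦
      (⟨G.smallVertex p.1, (isExternal_iff _).2 ⟨p.1, rfl, p.2⟩⟩ :
        {V : G.SmallVertex // G.IsExternal (G.vertexEdge V)})) := by
  have term : ∀ p q : TetPair N, G.glue p.1 (exitFace p) = none →
      Relation.ReflTransGen G.Next p q → p = q := by
    intro p q hp h
    rcases Relation.ReflTransGen.cases_head h with h | ⟨r, h, -⟩
    · exact h
    · exact absurd h (not_next_of_eq_none hp)
  constructor
  · rintro ⟨p, hp⟩ ⟨q, hq⟩ h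
    rcases G.smallVertex_eq_iff.1 (Subtype.ext_iff.1 h) with h | h
    · exact Subtype.ext (term _ _ hp h)
    · exact Subtype.ext (term _ _ hq h).symm
  · rintro ⟨V, hV⟩
    obtain ⟨p, hpE, hp⟩ := (isExternal_iff _).1 hV
    rcases (vertexEdge_eq_edgeOf_iff V p).1 hpE.symm with rfl | rfl
    · exact ⟨⟨p, hp⟩, rfl⟩
    -- At the other end of the edge the chain starts at `p.rev`: a predecessor would reverse to a
    -- successor of `p`.
    · obtain ⟨q, hq, hq'⟩ := exists_terminal (G := G) (p := p.rev)
        (fun q h ↦ not_next_of_eq_none hp h.rev)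
      exact ⟨⟨q, hq'⟩, Subtype.ext (G.smallVertex_eq_iff.2 (Or.inr hq))⟩

end TetGluing


/-! ### Counting by fibres. -/

theorem sum_natCard_eq_natCard {α β : Type*} [Finite α] [Fintype β] {P : β → α → Prop}
    {Q : α → Prop} (h1 : ∀ b a, P b a → Q a) (h2 : ∀ a, Q a → ∃! b, P b a) :
    ∑ b, Nat.card {a // P b a} = Nat.card {a // Q a} := by
  rw [← Nat.card_sigma]
  refine Nat.card_eq_of_bijective (fun x ↦ ⟨x.2.1, h1 _ _ x.2.2⟩) ⟨?_, ?_⟩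
  · rintro ⟨b, a, h⟩ ⟨b', a', h'⟩ h3
    obtain rfl : a = a' := congrArg Subtype.val h3
    obtain rfl := (h2 a (h1 _ _ h)).unique h h'
    rfl
  · rintro ⟨a, h⟩
    obtain ⟨b, hb, -⟩ := h2 a h
    exact ⟨⟨b, a, hb⟩, rfl⟩

theorem sum_natCard_fiber {α β : Type*} [Finite α] [Fintype β] (f : α → β) :
    ∑ b, Nat.card {a // f a = b} = Nat.card α := by
  rw [← Nat.card_sigma, Nat.card_congr (Equiv.sigmaFiberEquiv f)]

theorem natCard_eq_mul_of_fiber {α β : Type*} [Finite α] [Finite β] (f : α → β) (k : ℕ)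
    (h : ∀ b, Nat.card {a // f a = b} = k) : Nat.card α = k * Nat.card β := by
  have := Fintype.ofFinite β
  rw [← Nat.card_congr (Equiv.sigmaFiberEquiv f), Nat.card_sigma, Finset.sum_congr rfl
    (fun b _ ↦ h b), Finset.sum_const, Finset.card_univ, smul_eq_mul, mul_comm,
    Nat.card_eq_fintype_card]

namespace TetGluing

variable {N : ℕ} {G : TetGluing N}

instance : Finite G.SmallVertex := inferInstanceAs (Finite (Quot _))
instance : Finite G.SmallSide := inferInstanceAs (Finite (Quot _))
instance : Finite G.SmallComp := inferInstanceAs (Finite (Quot _))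
instance : Fintype G.SmallComp := Fintype.ofFinite _
instance : Fintype G.SmallVertex := Fintype.ofFinite _
instance : Finite G.Arc := inferInstanceAs (Finite {x : TetPair N // G.glue x.1 x.2.1.2 = none})
instance : Finite G.Circle := inferInstanceAs (Finite (Quot _))
instance : Finite G.BigFace :=
  inferInstanceAs (Finite {f : Fin N × Fin 4 // G.glue f.1 f.2 = none})
instance : Fintype G.BigFace := Fintype.ofFinite _

/-! ### Vertices, sides and arcs of the small boundary -/

theorem natCard_vertex_eq (P : G.Edge → Prop) :
    Nat.card {V : G.SmallVertex // P (G.vertexEdge V)} = 2 * Nat.card {E // P E} := by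
  refine natCard_eq_mul_of_fiber (fun V ↦ ⟨G.vertexEdge V.1, V.2⟩) 2 ?_
  rintro ⟨E, hE⟩
  obtain ⟨p, rfl⟩ := edgeOf_surjective E
  refine Nat.card_eq_two_iff.2 ⟨⟨⟨G.smallVertex p, hE⟩, rfl⟩,
    ⟨⟨G.smallVertex p.rev, by simpa [edgeOf_rev] using hE⟩, Subtype.ext (edgeOf_rev p)⟩, ?_, ?_⟩
  · intro h
    exact smallVertex_rev_ne p (congrArg (fun x ↦ x.1.1) h).symm
  · refine Set.eq_univ_of_forall ?_
    rintro ⟨⟨V, hV⟩, h⟩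
    rcases (vertexEdge_eq_edgeOf_iff V p).1 (congrArg Subtype.val h) with rfl | rfl
    · exact Or.inl rfl
    · exact Or.inr rfl

theorem SideRel.symm {x y : TetPair N} (h : G.SideRel x y) : G.SideRel y x := by
  obtain ⟨σ, h1, h2⟩ := h
  refine ⟨σ⁻¹, ?_, by simp [h2]⟩
  rw [h2]
  exact G.glue_symm _ _ _ _ h1

theorem SideRel.right_unique {x y z : TetPair N} (h : G.SideRel x y) (h' : G.SideRel x z) :
    y = z := by
  obtain ⟨σ, h1, h2⟩ := h
  obtain ⟨τ, h3, h4⟩ := h'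
  rw [h1, Option.some.injEq, Prod.mk.injEq] at h3
  obtain ⟨h5, rfl⟩ := h3
  exact TetPair.ext' h5 (h2.trans h4.symm)

theorem SideRel.ne {x y : TetPair N} (h : G.SideRel x y) : x ≠ y := by
  rintro rfl
  obtain ⟨σ, h1, h2⟩ := h
  refine G.glue_ne_self _ _ _ _ h1 (Prod.ext rfl ?_)
  exact (congrArg Prod.snd h2).symm

/-- `SideRel` is a partial matching, so classes have at most two elements. -/
theorem smallSide_eq_iff {x y : TetPair N} :
    G.smallSide x = G.smallSide y ↔ x = y ∨ G.SideRel x y := by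
  constructor
  · intro h
    replace h := Quot.eqvGen_exact h
    induction h with
    | rel _ _ h => exact Or.inr h
    | refl => exact Or.inl rfl
    | symm _ _ _ ih => exact ih.imp Eq.symm SideRel.symm
    | trans _ _ _ _ _ ih1 ih2 =>
      rcases ih1 with rfl | ih1
      · exact ih2
      · rcases ih2 with rfl | ih2
        · exact Or.inr ih1
        · exact Or.inl (ih1.symm.right_unique ih2)
  · rintro (rfl | h)
    · rfl
    · exact Quot.sound h

theorem smallComp_eq_of_sideRel {x y : TetPair N} (h : G.SideRel x y) :
    G.smallComp x.1 x.2.1.1 = G.smallComp y.1 y.2.1.1 := by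
  obtain ⟨σ, h1, h2⟩ := h
  exact Quot.sound ⟨_, σ, h1, x.2.2.symm, by simp [h2]⟩

theorem exists_sideRel_or (x : TetPair N) :
    (∃ y, G.SideRel x y) ∨ G.glue x.1 x.2.1.2 = none := by
  rcases h : G.glue x.1 x.2.1.2 with _ | ⟨T, σ⟩
  · exact Or.inr rfl
  · exact Or.inl ⟨(T, ⟨(σ x.2.1.1, σ x.2.1.2), fun h ↦ x.2.2 (σ.injective h)⟩), σ, h, rfl⟩

theorem not_sideRel_of_eq_none {x y : TetPair N} (h : G.glue x.1 x.2.1.2 = none) :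
    ¬ G.SideRel x y := by
  rintro ⟨σ, h1, -⟩
  simp [h] at h1

theorem natCard_triangle_sides (s : G.SmallComp) :
    Nat.card {x : TetPair N // G.smallComp x.1 x.2.1.1 = s} =
      3 * Nat.card {x : Fin N × Fin 4 // G.smallComp x.1 x.2 = s} := by
  refine natCard_eq_mul_of_fiber (fun x ↦ ⟨(x.1.1, x.1.2.1.1), x.2⟩) 3 ?_
  rintro ⟨⟨T, v⟩, hv⟩
  have h3 : ∀ v : Fin 4, Nat.card {w // v ≠ w} = 3 := by
    intro v
    rw [Nat.card_eq_fintype_card]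
    revert v
    decide
  rw [← h3 v]
  symm
  refine Nat.card_eq_of_bijective (fun w ↦ ⟨⟨(T, ⟨(v, w.1), w.2⟩), hv⟩, rfl⟩) ⟨?_, ?_⟩
  · rintro ⟨w, hw⟩ ⟨w', hw'⟩ h
    exact Subtype.ext (congrArg (fun x ↦ x.1.1.2.1.2) h)
  · rintro ⟨⟨⟨T', ⟨v', w⟩, hne⟩, hx⟩, h⟩
    simp only [Subtype.mk.injEq, Prod.mk.injEq] at h
    obtain ⟨rfl, rfl⟩ := h
    exact ⟨⟨w, hne⟩, rfl⟩

/-- An inner side lies on two triangles; a boundary side lies on one triangle, and its arc stands in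
for the second. -/
theorem two_mul_natCard_smallSide (s : G.SmallComp) :
    2 * Nat.card {S : G.SmallSide // ∃ x, G.smallSide x = S ∧ G.smallComp x.1 x.2.1.1 = s} =
      3 * Nat.card {x : Fin N × Fin 4 // G.smallComp x.1 x.2 = s} +
        Nat.card {A : G.Arc // G.smallComp A.1.1 A.1.2.1.1 = s} := by
  rw [← natCard_triangle_sides, ← Nat.card_sum]
  symm
  refine natCard_eq_mul_of_fiber (Sum.elim (fun x ↦ ⟨G.smallSide x.1, x.1, rfl, x.2⟩)
    (fun A ↦ ⟨G.smallSide A.1.1, A.1.1, rfl, A.2⟩)) 2 ?_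
  rintro ⟨S, x, rfl, hx⟩
  rw [Nat.card_eq_two_iff]
  rcases exists_sideRel_or (G := G) x with ⟨y, hy⟩ | hn
  · refine ⟨⟨.inl ⟨x, hx⟩, rfl⟩, ⟨.inl ⟨y, (smallComp_eq_of_sideRel hy).symm.trans hx⟩,
      Subtype.ext (smallSide_eq_iff.2 (Or.inr hy.symm))⟩, ?_, ?_⟩
    · intro h
      exact hy.ne (congrArg Subtype.val (Sum.inl_injective (congrArg Subtype.val h)))
    · refine Set.eq_univ_of_forall ?_
      rintro ⟨⟨z, hz⟩ | ⟨A, hA⟩, h⟩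
      · rcases smallSide_eq_iff.1 (congrArg Subtype.val h).symm with rfl | h
        · exact Or.inl rfl
        · obtain rfl := hy.right_unique h
          exact Or.inr rfl
      · exfalso
        rcases smallSide_eq_iff.1 (congrArg Subtype.val h) with h | h
        · rw [← h] at hy
          exact not_sideRel_of_eq_none A.2 hy
        · exact not_sideRel_of_eq_none A.2 h
  · refine ⟨⟨.inl ⟨x, hx⟩, rfl⟩, ⟨.inr ⟨⟨x, hn⟩, hx⟩, rfl⟩, fun h ↦ Sum.inl_ne_inr (congrArg Subtype.val h), ?_⟩
    refine Set.eq_univ_of_forall ?_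
    have key : ∀ z, G.smallSide x = G.smallSide z → x = z := fun z h ↦
      (smallSide_eq_iff.1 h).resolve_right (not_sideRel_of_eq_none hn)
    rintro ⟨⟨z, hz⟩ | ⟨⟨z, hz'⟩, hA⟩, h⟩
    · obtain rfl := key z (congrArg Subtype.val h).symm
      exact Or.inl rfl
    · obtain rfl := key z (congrArg Subtype.val h).symm
      exact Or.inr rfl

theorem smallEuler_eq (s : G.SmallComp) :
    G.smallEuler s = (Nat.card {V // G.vertexComp V = s} : ℤ)
    - Nat.card {S : G.SmallSide // ∃ x, G.smallSide x = S ∧ G.smallComp x.1 x.2.1.1 = s}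
    + Nat.card {x : Fin N × Fin 4 // G.smallComp x.1 x.2 = s} := by
  rw [smallEuler]
  congr 3
  refine Nat.card_congr (Equiv.subtypeEquivRight fun V ↦ ?_)
  constructor
  · rintro ⟨x, rfl, h⟩
    exact h
  · intro h
    obtain ⟨x, rfl⟩ := Quot.exists_rep V
    exact ⟨x, rfl, h⟩

theorem smallCircles_ne_zero (A : G.Arc) : G.smallCircles (G.smallComp A.1.1 A.1.2.1.1) ≠ 0 := by
  rw [smallCircles, Nat.card_ne_zero]
  exact ⟨⟨⟨G.circle A, A, rfl, rfl⟩⟩, inferInstance⟩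

theorem IsTorus.arc_ne {s : G.SmallComp} (hs : G.IsTorus s) (A : G.Arc) :
    G.smallComp A.1.1 A.1.2.1.1 ≠ s := by
  rintro rfl
  exact smallCircles_ne_zero A hs.2

theorem IsFramed.exists_arc (hG : G.IsFramed) {s : G.SmallComp} (hs : ¬ G.IsTorus s) :
    ∃ A : G.Arc, G.smallComp A.1.1 A.1.2.1.1 = s := by
  have : G.smallCircles s ≠ 0 := by
    rcases hG s with h | h | h
    · rw [h.2]; decide
    · rw [h.2]; decide
    · exact absurd h hs
  obtain ⟨⟨⟨c, A, -, hA⟩⟩, -⟩ := Nat.card_ne_zero.1 this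
  exact ⟨A, hA⟩

/-- A small torus has twice as many triangles as vertices. -/
theorem IsTorus.natCard_triangles {s : G.SmallComp} (hs : G.IsTorus s) :
    Nat.card {x : Fin N × Fin 4 // G.smallComp x.1 x.2 = s} =
      2 * Nat.card {V // G.vertexComp V = s} := by
  have h1 := hs.1
  have h2 := two_mul_natCard_smallSide s
  have h3 : Nat.card {A : G.Arc // G.smallComp A.1.1 A.1.2.1.1 = s} = 0 := by
    have : IsEmpty {A : G.Arc // G.smallComp A.1.1 A.1.2.1.1 = s} := ⟨fun A ↦ hs.arc_ne A.1 A.2⟩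
    exact Nat.card_of_isEmpty
  rw [smallEuler_eq] at h1
  omega

/-! ### Components and circles -/

theorem sum_natCard_arc :
    ∑ s : G.SmallComp, Nat.card {A : G.Arc // G.smallComp A.1.1 A.1.2.1.1 = s} =
      Nat.card G.Arc :=
  sum_natCard_fiber _

theorem sum_natCard_triangle :
    ∑ s : G.SmallComp, Nat.card {x : Fin N × Fin 4 // G.smallComp x.1 x.2 = s} = 4 * N := by
  rw [sum_natCard_fiber fun x : Fin N × Fin 4 ↦ G.smallComp x.1 x.2]
  simp [mul_comm]

theorem sum_natCard_vertex :
    ∑ s : G.SmallComp, Nat.card {V // G.vertexComp V = s} = 2 * Nat.card G.Edge := by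
  have h := natCard_vertex_eq fun _ : G.Edge ↦ True
  rw [Nat.card_congr (Equiv.subtypeUnivEquiv fun _ ↦ trivial),
    Nat.card_congr (Equiv.subtypeUnivEquiv fun _ ↦ trivial)] at h
  rw [sum_natCard_fiber, h]

theorem smallComp_eq_of_endpoint {A : G.Arc} {V : G.SmallVertex} (h : G.ArcEndpoint A V) :
    G.vertexComp V = G.smallComp A.1.1 A.1.2.1.1 := by
  obtain ⟨x, rfl, h1, h2, -⟩ := h
  rw [vertexComp_smallVertex, h1, h2]

theorem smallComp_eq_of_circle_eq {A B : G.Arc} (h : G.circle A = G.circle B) :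
    G.smallComp A.1.1 A.1.2.1.1 = G.smallComp B.1.1 B.1.2.1.1 := by
  have := congrArg (Quot.lift (fun A : G.Arc ↦ G.smallComp A.1.1 A.1.2.1.1) (by
    rintro A B ⟨V, hA, hB⟩
    exact (smallComp_eq_of_endpoint hA).symm.trans (smallComp_eq_of_endpoint hB))) h
  exact this

theorem sum_smallCircles : ∑ s, G.smallCircles s = Nat.card G.Circle := by
  simp only [smallCircles]
  rw [sum_natCard_eq_natCard (Q := fun _ ↦ True) (fun _ _ _ ↦ trivial)]
  · exact Nat.card_congr (Equiv.subtypeUnivEquiv fun _ ↦ trivial)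
  · intro c _
    obtain ⟨A, rfl⟩ := Quot.exists_rep c
    refine ⟨_, ⟨A, rfl, rfl⟩, ?_⟩
    rintro s ⟨B, hB, rfl⟩
    exact smallComp_eq_of_circle_eq hB

theorem bigComp_eq_of_side {f g : G.BigFace} {E : G.Edge} (hf : G.BigFaceSide f E)
    (hg : G.BigFaceSide g E) : G.bigComp f = G.bigComp g :=
  Quot.sound ⟨E, hf, hg⟩

theorem bigFaceSide_of_endpoint {A : G.Arc} {V : G.SmallVertex} (h : G.ArcEndpoint A V) :
    G.BigFaceSide ⟨(A.1.1, A.1.2.1.2), A.2⟩ (G.vertexEdge V) := by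
  obtain ⟨x, rfl, h1, h2, h3⟩ := h
  refine ⟨x.toEdge, rfl, h1, ?_⟩
  simp only [TetPair.toEdge, Sym2.mem_iff, not_or, h2]
  exact ⟨A.1.2.2.symm, h3.symm⟩

theorem bigComp_eq_of_circle_eq {A B : G.Arc} (h : G.circle A = G.circle B) :
    G.bigComp ⟨(A.1.1, A.1.2.1.2), A.2⟩ = G.bigComp ⟨(B.1.1, B.1.2.1.2), B.2⟩ := by
  have := congrArg (Quot.lift (fun A : G.Arc ↦ G.bigComp ⟨(A.1.1, A.1.2.1.2), A.2⟩) (by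
    rintro A B ⟨V, hA, hB⟩
    exact bigComp_eq_of_side (bigFaceSide_of_endpoint hA) (bigFaceSide_of_endpoint hB))) h
  exact this

theorem sum_bigHoles : ∑ C, G.bigHoles C = Nat.card G.Circle := by
  simp only [bigHoles]
  rw [sum_natCard_eq_natCard (Q := fun _ ↦ True) (fun _ _ _ ↦ trivial)]
  · exact Nat.card_congr (Equiv.subtypeUnivEquiv fun _ ↦ trivial)
  · intro c _
    obtain ⟨A, rfl⟩ := Quot.exists_rep c
    refine ⟨_, ⟨A, rfl, rfl⟩, ?_⟩
    rintro C ⟨B, hB, rfl⟩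
    exact bigComp_eq_of_circle_eq hB

theorem isExternal_iff_bigFaceSide (E : G.Edge) : G.IsExternal E ↔ ∃ f, G.BigFaceSide f E := by
  constructor
  · rintro ⟨x, i, hx, hi, h⟩
    exact ⟨⟨(x.1, i), h⟩, x, hx, rfl, hi⟩
  · rintro ⟨f, x, hx, h1, h2⟩
    exact ⟨x, f.1.2, hx, h2, h1 ▸ f.2⟩

theorem sum_natCard_bigEdges :
    ∑ C, Nat.card {E : G.Edge // ∃ f, G.bigComp f = C ∧ G.BigFaceSide f E} =
      Nat.card {E // G.IsExternal E} := by
  refine sum_natCard_eq_natCard ?_ ?_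
  · rintro C E ⟨f, -, h⟩
    exact (isExternal_iff_bigFaceSide E).2 ⟨f, h⟩
  · intro E hE
    obtain ⟨f, hf⟩ := (isExternal_iff_bigFaceSide E).1 hE
    refine ⟨_, ⟨f, rfl, hf⟩, ?_⟩
    rintro C ⟨g, rfl, hg⟩
    exact bigComp_eq_of_side hg hf

theorem sum_natCard_bigFaces :
    ∑ C, Nat.card {f : G.BigFace // G.bigComp f = C} = Nat.card G.BigFace :=
  sum_natCard_fiber _

theorem natCard_arc : Nat.card G.Arc = 3 * Nat.card G.BigFace := by
  refine natCard_eq_mul_of_fiber (fun A : G.Arc ↦ (⟨(A.1.1, A.1.2.1.2), A.2⟩ : G.BigFace)) 3 ?_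
  rintro ⟨⟨T, i⟩, hi⟩
  have h3 : ∀ v : Fin 4, Nat.card {w // w ≠ v} = 3 := by
    intro v
    rw [Nat.card_eq_fintype_card]
    revert v
    decide
  rw [← h3 i]
  symm
  refine Nat.card_eq_of_bijective (fun w ↦ ⟨⟨(T, ⟨(w.1, i), w.2⟩), hi⟩, rfl⟩) ⟨?_, ?_⟩
  · rintro ⟨w, hw⟩ ⟨w', hw'⟩ h
    exact Subtype.ext (congrArg (fun x ↦ x.1.1.2.1.1) h)
  · rintro ⟨⟨⟨T', ⟨w, v'⟩, hne⟩, hx⟩, h⟩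
    have h1 := congrArg (fun f : G.BigFace ↦ f.1.1) h
    have h2 := congrArg (fun f : G.BigFace ↦ f.1.2) h
    simp only at h1 h2
    subst h1 h2
    exact ⟨⟨w, hne⟩, rfl⟩

/-- A face is the exit face of exactly three edge ends: each of its sides, taken in one of the two
directions. -/
theorem natCard_terminal :
    Nat.card {p : TetPair N // G.glue p.1 (exitFace p) = none} = 3 * Nat.card G.BigFace := by
  refine natCard_eq_mul_of_fiber
    (fun p : {p : TetPair N // G.glue p.1 (exitFace p) = none} ↦
      (⟨(p.1.1, exitFace p.1), p.2⟩ : G.BigFace)) 3 ?_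
  rintro ⟨⟨T, i⟩, hi⟩
  have h3 : ∀ i : Fin 4, Nat.card {p : {p : Fin 4 × Fin 4 // p.1 ≠ p.2} //
      evenThird p.1.1 p.1.2 = i} = 3 := by
    intro v
    rw [Nat.card_eq_fintype_card]
    revert v
    decide
  rw [← h3 i]
  symm
  refine Nat.card_eq_of_bijective (fun p ↦ ⟨⟨(T, p.1), by
    rw [exitFace, p.2]; exact hi⟩, Subtype.ext (Prod.ext rfl p.2)⟩) ⟨?_, ?_⟩
  · rintro ⟨w, hw⟩ ⟨w', hw'⟩ h
    exact Subtype.ext (congrArg (fun x ↦ x.1.1.2) h)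
  · rintro ⟨⟨⟨T', p⟩, hx⟩, h⟩
    have h1 := congrArg (fun f : G.BigFace ↦ f.1.1) h
    have h2 := congrArg (fun f : G.BigFace ↦ f.1.2) h
    simp only at h1 h2
    subst h1
    exact ⟨⟨p, h2⟩, rfl⟩

theorem two_mul_natCard_external :
    2 * Nat.card {E // G.IsExternal E} = 3 * Nat.card G.BigFace := by
  rw [← natCard_vertex_eq, ← natCard_terminal]
  exact (Nat.card_eq_of_bijective _ bijective_terminal).symm

theorem bigHalfDim_eq : G.bigHalfDim = (3 * Nat.card G.BigFace : ℚ) / 4 - Nat.card G.Circle / 2 := by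
  -- Substituting the genus, $3g-3+h=\tfrac32E-\tfrac32F-\tfrac12h$ for a component with $E$ edges
  -- and $F$ faces.
  have h1 : G.bigHalfDim = ∑ C, ((3 / 2 : ℚ) *
      Nat.card {E : G.Edge // ∃ f, G.bigComp f = C ∧ G.BigFaceSide f E}
      - (3 / 2 : ℚ) * Nat.card {f : G.BigFace // G.bigComp f = C} - (1 / 2 : ℚ) * G.bigHoles C) := by
    refine Finset.sum_congr rfl fun C _ ↦ ?_
    rw [bigGenus]
    ring
  have h2 : (2 : ℚ) * Nat.card {E // G.IsExternal E} = 3 * Nat.card G.BigFace := by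
    exact_mod_cast two_mul_natCard_external (G := G)
  rw [h1, Finset.sum_sub_distrib, Finset.sum_sub_distrib, ← Finset.mul_sum, ← Finset.mul_sum,
    ← Finset.mul_sum, ← Nat.cast_sum, ← Nat.cast_sum, ← Nat.cast_sum, sum_natCard_bigEdges,
    sum_natCard_bigFaces, sum_bigHoles]
  linear_combination (3 / 4 : ℚ) * h2

theorem natCard_edge : Nat.card G.Edge =
    Nat.card {E // G.IsExternal E} + Nat.card G.InternalEdge := by
  classical
  rw [← Nat.card_sum]
  exact Nat.card_congr (Equiv.sumCompl G.IsExternal).symm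

open Classical in
theorem IsFramed.sum_smallEuler (hG : G.IsFramed) :
    ∑ s, G.smallEuler s = Nat.card G.Circle - 2 * G.numAnnuli := by
  -- The pairs (Euler characteristic, circles) are $(1,1)$, $(0,2)$, $(0,0)$ for a disc, an annulus
  -- and a torus.
  have h1 : ∀ s, G.smallEuler s = G.smallCircles s - 2 * (if G.IsAnnulus s then 1 else 0) := by
    intro s
    rcases hG s with h | h | h
    · have : ¬ G.IsAnnulus s := fun h' ↦ by simpa [h.2] using h'.2
      simp [h.1, h.2, this]
    · simp [h, h.1, h.2]
    · have : ¬ G.IsAnnulus s := fun h' ↦ by simpa [h.2] using h'.2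
      simp [h.1, h.2, this]
  rw [Finset.sum_congr rfl fun s _ ↦ h1 s, Finset.sum_sub_distrib, ← Nat.cast_sum,
    sum_smallCircles, ← Finset.mul_sum, Finset.sum_boole, numAnnuli,
    Nat.card_eq_fintype_card (α := {s // G.IsAnnulus s}), Fintype.card_subtype]

/-- With $B$ unglued faces, $V-S+F=2\,\#\text{edges}-\tfrac12(12N+3B)+4N$, while framing makes this
the number of circles minus $2a$. -/
theorem IsFramed.natCard_internalEdge (hG : G.IsFramed) :
    (Nat.card G.InternalEdge : ℚ) = N - G.bigHalfDim - G.numAnnuli := by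
  have h1 := hG.sum_smallEuler
  have h2 := Finset.sum_congr rfl fun (s : G.SmallComp) (_ : s ∈ Finset.univ) ↦
    two_mul_natCard_smallSide s
  rw [← Finset.mul_sum, Finset.sum_add_distrib, ← Finset.mul_sum, sum_natCard_arc,
    sum_natCard_triangle, natCard_arc] at h2
  rw [Finset.sum_congr rfl fun s _ ↦ smallEuler_eq s, Finset.sum_add_distrib,
    Finset.sum_sub_distrib, ← Nat.cast_sum, ← Nat.cast_sum, ← Nat.cast_sum, sum_natCard_vertex,
    sum_natCard_triangle, natCard_edge] at h1
  have h3 := two_mul_natCard_external (G := G)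
  rw [bigHalfDim_eq]
  qify at h1 h2 h3
  linarith

end TetGluing


/-! ### Sums over the edges and the ordered vertex pairs of one tetrahedron. -/

theorem sum_tetEdges {M : Type*} [AddCommMonoid M] (f : {e : Sym2 (Fin 4) // ¬ e.IsDiag} → M) :
    ∑ e, f e = f ⟨s(0, 1), by decide⟩ + f ⟨s(2, 3), by decide⟩ + (f ⟨s(0, 2), by decide⟩ +
      f ⟨s(1, 3), by decide⟩) + (f ⟨s(0, 3), by decide⟩ + f ⟨s(1, 2), by decide⟩) := by
  have h : (Finset.univ : Finset {e : Sym2 (Fin 4) // ¬ e.IsDiag}) =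
      {⟨s(0, 1), by decide⟩, ⟨s(2, 3), by decide⟩, ⟨s(0, 2), by decide⟩, ⟨s(1, 3), by decide⟩,
        ⟨s(0, 3), by decide⟩, ⟨s(1, 2), by decide⟩} := by decide
  rw [h, Finset.sum_insert (by decide), Finset.sum_insert (by decide),
    Finset.sum_insert (by decide), Finset.sum_insert (by decide), Finset.sum_insert (by decide),
    Finset.sum_singleton]
  abel

theorem sum_tetPairs {M : Type*} [AddCommMonoid M] (f : Fin 4 → Fin 4 → M) :
    ∑ p : {p : Fin 4 × Fin 4 // p.1 ≠ p.2}, f p.1.1 p.1.2 =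
      f 0 1 + f 0 2 + f 0 3 + f 1 0 + f 1 2 + f 1 3 + f 2 0 + f 2 1 + f 2 3 + f 3 0 + f 3 1
        + f 3 2 := by
  rw [← Finset.sum_subtype (Finset.univ.filter fun p : Fin 4 × Fin 4 ↦ p.1 ≠ p.2) (by simp)
    (fun p ↦ f p.1 p.2), Finset.sum_filter, Fintype.sum_prod_type]
  simp [Fin.sum_univ_four]
  abel

namespace TetGluing

variable {N : ℕ} {G : TetGluing N} {R : Type*} [CommRing R]

/-! ### Functions on the edges of the triangulation -/

variable (G) in
open Classical in
/-- Extension by zero of a function on the internal edges. -/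
def extendZero (n : G.InternalEdge → R) (E : G.Edge) : R :=
  if h : G.IsExternal E then 0 else n ⟨E, h⟩

theorem extendZero_of_isExternal (n : G.InternalEdge → R) {E : G.Edge} (h : G.IsExternal E) :
    G.extendZero n E = 0 := dif_pos h

@[simp] theorem extendZero_coe (n : G.InternalEdge → R) (I : G.InternalEdge) :
    G.extendZero n I.1 = n I := dif_neg I.2

/-- The value of a function `m` of edges at the edge `vw` of the tetrahedron `T`. -/
def val (m : G.Edge → R) (T : Fin N) (v w : Fin 4) : R :=
  if h : v ≠ w then m (G.edgeOf (T, ⟨(v, w), h⟩)) else 0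

theorem val_of_ne (m : G.Edge → R) (T : Fin N) {v w : Fin 4} (h : v ≠ w) :
    val m T v w = m (G.edgeOf (T, ⟨(v, w), h⟩)) := dif_pos h

theorem val_comm (m : G.Edge → R) (T : Fin N) (v w : Fin 4) : val m T v w = val m T w v := by
  by_cases h : v = w
  · rw [h]
  · rw [val_of_ne m T h, val_of_ne m T (Ne.symm h)]
    exact congrArg m (edgeOf_rev (T, ⟨(w, v), Ne.symm h⟩))

theorem val_glue (m : G.Edge → R) {T T' : Fin N} {i v w : Fin 4} {σ : Equiv.Perm (Fin 4)}
    (h : G.glue T i = some (T', σ)) (hv : i ≠ v) (hw : i ≠ w) :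
    val m T' (σ v) (σ w) = val m T v w := by
  by_cases hvw : v = w
  · simp [val, hvw]
  · rw [val_of_ne m T hvw, val_of_ne m T' (σ.injective.ne hvw)]
    exact congrArg m (edgeOf_eq_of_endRel ⟨i, σ, h, hv, hw, rfl⟩).symm

theorem val_extendZero_of_unglued (n : G.InternalEdge → R) {T : Fin N} {i v w : Fin 4}
    (h : G.glue T i = none) (hv : i ≠ v) (hw : i ≠ w) : val (G.extendZero n) T v w = 0 := by
  by_cases hvw : v = w
  · simp [val, hvw]
  · rw [val_of_ne _ T hvw]
    refine extendZero_of_isExternal n ⟨_, i, rfl, ?_, h⟩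
    simp [TetPair.toEdge, hv, hw]

/-- The sums of the values of `m` at the pairs of opposite edges of the tetrahedron `T`. -/
def oppSum (m : G.Edge → R) (T : Fin N) : Fin 3 → R :=
  ![val m T 0 1 + val m T 2 3, val m T 0 2 + val m T 1 3, val m T 0 3 + val m T 1 2]

/-- Regroups a sum over internal edges by tetrahedra. The target `M` is a general module so that it
serves both the logarithmic sums and, through `Additive ℂˣ`, the products. -/
theorem sum_smul_sum_around {M : Type*} [AddCommGroup M] [Module R M] (n : G.InternalEdge → R)
    (F : Fin N → Fin 3 → M) :
    ∑ I, n I • ∑ x ∈ G.around I, F x.1 (edgeParam x.2) =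
      ∑ T, ∑ i, oppSum (G.extendZero n) T i • F T i := by
  classical
  have h1 : ∀ I, n I • ∑ x ∈ G.around I, F x.1 (edgeParam x.2) =
      ∑ x, (if G.edge x = I.1 then n I else 0) • F x.1 (edgeParam x.2) := by
    intro I
    simp only [around, Finset.smul_sum, Finset.sum_filter, ite_smul, zero_smul, smul_ite,
      smul_zero]
  have h2 : ∀ x, ∑ I : G.InternalEdge, (if G.edge x = I.1 then n I else 0) =
      G.extendZero n (G.edge x) := by
    intro x
    by_cases hx : G.IsExternal (G.edge x)
    · rw [extendZero_of_isExternal n hx]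
      refine Finset.sum_eq_zero fun I _ ↦ if_neg ?_
      rintro h
      exact I.2 (h ▸ hx)
    · rw [Finset.sum_eq_single ⟨G.edge x, hx⟩]
      · simp [extendZero, hx]
      · intro I _ hI
        exact if_neg fun h ↦ hI (Subtype.ext h.symm)
      · exact fun h ↦ absurd (Finset.mem_univ _) h
  rw [Finset.sum_congr rfl fun I _ ↦ h1 I, Finset.sum_comm]
  simp only [← Finset.sum_smul, h2]
  rw [Fintype.sum_prod_type]
  refine Finset.sum_congr rfl fun T _ ↦ ?_
  have h3 : ∀ v w : Fin 4, ∀ h : v ≠ w, ∀ h', G.extendZero n (G.edge (T, ⟨s(v, w), h'⟩)) =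
    val (G.extendZero n) T v w := fun v w h _ ↦ (val_of_ne _ T h).symm
  rw [sum_tetEdges, Fin.sum_univ_three]
  rw [h3 0 1 (by decide), h3 2 3 (by decide), h3 0 2 (by decide), h3 1 3 (by decide),
    h3 0 3 (by decide), h3 1 2 (by decide)]
  simp [edgeParam, oppSum, add_smul]

/-! ### Poisson commutativity of the gluing functions -/

/-- The contribution of the faces of the tetrahedra to the Poisson bracket. -/
def faceTerm (m m' : G.Edge → R) (T : Fin N) (v i : Fin 4) : R :=
  val m' T (evenThird i v) (evenThird v i) *
    (val m T (evenThird v i) v - val m T v (evenThird i v))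

/-- Two distinct non-opposite edges of a tetrahedron lie on a unique common face, so every product
in the bracket belongs to one face. -/
theorem sum_faceTerm (m m' : G.Edge → R) (T : Fin N) :
    ∑ p : {p : Fin 4 × Fin 4 // p.1 ≠ p.2}, faceTerm m m' T p.1.1 p.1.2 =
      ∑ i, oppSum m' T i * (oppSum m T (i + 1) - oppSum m T (i + 2)) := by
  rw [sum_tetPairs (faceTerm m m' T), Fin.sum_univ_three]
  simp only [faceTerm, evenThird, oppSum]
  simp [val_comm m T 1 0, val_comm m T 2 0, val_comm m T 3 0, val_comm m T 2 1, val_comm m T 3 1,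
    val_comm m T 3 2, val_comm m' T 1 0, val_comm m' T 2 0, val_comm m' T 3 0, val_comm m' T 2 1,
    val_comm m' T 3 1, val_comm m' T 3 2]
  ring

/-- The values along the sides match, but the odd gluing exchanges the other two vertices of the
face and so flips the sign. -/
theorem faceTerm_glue (m m' : G.Edge → R) {T T' : Fin N} {v i : Fin 4} {σ : Equiv.Perm (Fin 4)}
    (h : G.glue T i = some (T', σ)) (hv : v ≠ i) :
    faceTerm m m' T' (σ v) (σ i) = - faceTerm m m' T v i := by
  have hσ := G.glue_odd _ _ _ _ h
  simp only [faceTerm, evenThird_map σ hσ _ _ hv, evenThird_map σ hσ _ _ hv.symm]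
  have h1 := (evenThird_ne_right v i hv).symm
  have h2 := (evenThird_ne_left i v hv.symm).symm
  rw [val_glue m' h h1 h2, val_glue m h h2 hv.symm, val_glue m h hv.symm h1,
    val_comm m' T (evenThird v i), val_comm m T v (evenThird v i),
    val_comm m T v (evenThird i v)]
  ring

theorem faceTerm_unglued (n n' : G.InternalEdge → R) {T : Fin N} {v i : Fin 4}
    (h : G.glue T i = none) (hv : v ≠ i) :
    faceTerm (G.extendZero n) (G.extendZero n') T v i = 0 := by
  rw [faceTerm, val_extendZero_of_unglued n' h (evenThird_ne_left i v hv.symm).symm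
    (evenThird_ne_right v i hv).symm, zero_mul]

theorem sum_oppSum_mul_eq_zero (n n' : G.InternalEdge → R) :
    ∑ T, ∑ i, oppSum (G.extendZero n') T i *
      (oppSum (G.extendZero n) T (i + 1) - oppSum (G.extendZero n) T (i + 2)) = 0 := by
  classical
  simp only [← sum_faceTerm]
  rw [← Fintype.sum_prod_type (f := fun x : TetPair N ↦
    faceTerm (G.extendZero n) (G.extendZero n') x.1 x.2.1.1 x.2.1.2)]
  -- The involution matches glued sides and fixes unglued ones, whose terms vanish by themselves.
  have h1 : ∀ x : TetPair N, ∃ y, (G.SideRel x y) ∨ G.glue x.1 x.2.1.2 = none ∧ y = x := by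
    intro x
    rcases exists_sideRel_or (G := G) x with ⟨y, hy⟩ | h
    · exact ⟨y, Or.inl hy⟩
    · exact ⟨x, Or.inr ⟨h, rfl⟩⟩
  choose g hg using h1
  refine Finset.sum_involution (fun x _ ↦ g x) ?_ ?_ (fun _ _ ↦ Finset.mem_univ _) ?_
  · intro x _
    rcases hg x with ⟨σ, h1, h2⟩ | ⟨h1, h2⟩
    · simp only [h2, faceTerm_glue _ _ h1 x.2.2, add_neg_cancel]
    · rw [h2, faceTerm_unglued n n' h1 x.2.2, add_zero]
  · intro x _ hx
    rcases hg x with h | ⟨h1, h2⟩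
    · exact h.ne.symm
    · exact absurd (faceTerm_unglued n n' h1 x.2.2) hx
  · intro x _
    rcases hg x with h | ⟨h1, h2⟩
    · rcases hg (g x) with h' | ⟨h1, h2⟩
      · exact (h.symm.right_unique h').symm
      · exact absurd h.symm (not_sideRel_of_eq_none h1)
    · simp only [h2]

/-! ### Balanced functions -/

/-- The sums over the pairs of opposite edges of each tetrahedron are equal. -/
def Balanced (m : G.Edge → R) : Prop := ∀ T i, oppSum m T i = oppSum m T 0

/-- Twice the value at the corner `v` of `T` of the function of corners whose sums along the
edges are `m`. -/
def cornerVal (m : G.Edge → R) (T : Fin N) (v : Fin 4) : R :=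
  val m T v (v + 1) + val m T v (v + 2) - val m T (v + 1) (v + 2)

/-- Replacing $u$ by the fourth vertex $x$ changes the value by $(vu+wx)-(vx+wu)$, a difference of
two opposite-edge sums. -/
theorem Balanced.cornerVal_eq {m : G.Edge → R} (hm : Balanced m) (T : Fin N) {v w u : Fin 4}
    (h1 : v ≠ w) (h2 : v ≠ u) (h3 : w ≠ u) :
    cornerVal m T v = val m T v w + val m T v u - val m T w u := by
  have e1 := hm T 1
  have e2 := hm T 2
  simp [oppSum] at e1 e2
  have c := val_comm m T
  have c1 := c 1 0
  have c2 := c 2 0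
  have c3 := c 3 0
  have c4 := c 2 1
  have c5 := c 3 1
  have c6 := c 3 2
  rw [cornerVal]
  fin_cases v <;> fin_cases w <;> fin_cases u <;>
    first
    | exact absurd rfl h1
    | exact absurd rfl h2
    | exact absurd rfl h3
    | (simp [c1, c2, c3, c4, c5, c6]
       try first
         | ring1
         | linear_combination e1
         | linear_combination e2
         | linear_combination e1 - e2
         | linear_combination -e1
         | linear_combination -e2
         | linear_combination e2 - e1)

end TetGluing


theorem evenThird_ne_evenThird : ∀ v w : Fin 4, v ≠ w → evenThird v w ≠ evenThird w v := by decide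

namespace TetGluing

variable {N : ℕ} {G : TetGluing N} {R : Type*} [CommRing R]

/-- Both corner values can be computed inside the glued face, whose sides are identified. -/
theorem Balanced.cornerVal_glue {m : G.Edge → R} (hm : Balanced m) {T T' : Fin N} {i v : Fin 4}
    {σ : Equiv.Perm (Fin 4)} (h : G.glue T i = some (T', σ)) (hv : i ≠ v) :
    cornerVal m T' (σ v) = cornerVal m T v := by
  have h1 := evenThird_ne_left i v hv
  have h2 := evenThird_ne_right i v hv
  have h3 := evenThird_ne_left v i hv.symm
  have h4 := evenThird_ne_right v i hv.symm
  have h5 := evenThird_ne_evenThird i v hv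
  rw [hm.cornerVal_eq T h2.symm h3.symm h5, hm.cornerVal_eq T' (σ.injective.ne h2.symm)
    (σ.injective.ne h3.symm) (σ.injective.ne h5), val_glue m h hv h1.symm, val_glue m h hv h4.symm,
    val_glue m h h1.symm h4.symm]

/-- The function of corners of a balanced function of edges, as a function of the components of the
small boundary. -/
def Balanced.compVal {m : G.Edge → R} (hm : Balanced m) : G.SmallComp → R :=
  Quot.lift (fun x ↦ cornerVal m x.1 x.2) (by
    rintro ⟨T, v⟩ ⟨T', v'⟩ ⟨i, σ, h1, h2, h3⟩
    simp only at h1 h2 h3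
    rw [h3]
    exact (hm.cornerVal_glue h1 h2).symm)

theorem Balanced.two_mul_val {m : G.Edge → R} (hm : Balanced m) (T : Fin N) {v w : Fin 4}
    (h : v ≠ w) :
    2 * val m T v w = hm.compVal (G.smallComp T v) + hm.compVal (G.smallComp T w) := by
  have h1 := evenThird_ne_left v w h
  have h2 := evenThird_ne_right v w h
  change _ = cornerVal m T v + cornerVal m T w
  rw [hm.cornerVal_eq T h h1.symm h2.symm, hm.cornerVal_eq T h.symm h2.symm h1.symm,
    val_comm m T w v]
  ring

/-- In a framed gluing a component other than a torus has an arc. The corner value can be computed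
in the unglued face of that arc, whose sides are all external. -/
theorem Balanced.compVal_eq_zero (hG : G.IsFramed) {n : G.InternalEdge → R}
    (hm : Balanced (G.extendZero n)) {s : G.SmallComp} (hs : ¬ G.IsTorus s) :
    hm.compVal s = 0 := by
  obtain ⟨⟨⟨T, ⟨v, i⟩, hv⟩, hA⟩, rfl⟩ := hG.exists_arc hs
  have hv : i ≠ v := Ne.symm hv
  have h1 := evenThird_ne_left i v hv
  have h2 := evenThird_ne_right i v hv
  have h3 := evenThird_ne_left v i hv.symm
  have h4 := evenThird_ne_right v i hv.symm
  have h5 := evenThird_ne_evenThird i v hv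
  change cornerVal _ T v = 0
  rw [hm.cornerVal_eq T h2.symm h3.symm h5, val_extendZero_of_unglued n hA hv h1.symm,
    val_extendZero_of_unglued n hA hv h4.symm, val_extendZero_of_unglued n hA h1.symm h4.symm]
  simp

/-! ### The ends of the internal edges -/

open Classical in
theorem endsAt_eq (s : G.SmallComp) {I : G.InternalEdge} {p : TetPair N} (hp : G.edgeOf p = I.1) :
    G.endsAt s I = (if G.smallComp p.1 p.2.1.1 = s then 1 else 0) +
      (if G.smallComp p.1 p.2.1.2 = s then 1 else 0) := by
  have h := Nat.subtype_card (α := G.SmallVertex)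
    (p := fun V ↦ ∃ x : TetPair N, G.smallVertex x = V ∧ G.smallComp x.1 x.2.1.1 = s ∧
      G.edge (x.1, ⟨s(x.2.1.1, x.2.1.2), fun h ↦ x.2.2 (Sym2.mk_isDiag_iff.1 h)⟩) = I.1)
    (({G.smallVertex p, G.smallVertex p.rev} : Finset G.SmallVertex).filter
      fun V ↦ G.vertexComp V = s) (by
    intro V
    simp only [Finset.mem_filter, Finset.mem_insert, Finset.mem_singleton]
    rw [← vertexEdge_eq_edgeOf_iff, hp]
    constructor
    · rintro ⟨h1, h2⟩
      obtain ⟨x, rfl⟩ := Quot.exists_rep V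
      exact ⟨x, rfl, h2, h1⟩
    · rintro ⟨x, rfl, h1, h2⟩
      exact ⟨h2, h1⟩)
  rw [endsAt, h, Finset.card_filter, Finset.sum_pair (smallVertex_rev_ne p).symm]
  push_cast
  rfl

theorem sum_mul_endsAt (f : G.SmallComp → R) {I : G.InternalEdge} {p : TetPair N}
    (hp : G.edgeOf p = I.1) :
    ∑ s, f s * (G.endsAt s I : R) =
      f (G.smallComp p.1 p.2.1.1) + f (G.smallComp p.1 p.2.1.2) := by
  classical
  simp [endsAt_eq _ hp, mul_add, Finset.sum_add_distrib]

theorem not_isTorus_of_unglued {T : Fin N} {v i : Fin 4} (h : G.glue T i = none) (hv : v ≠ i) :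
    ¬ G.IsTorus (G.smallComp T v) :=
  fun hs ↦ hs.arc_ne ⟨(T, ⟨(v, i), hv⟩), h⟩ rfl

/-- External edges need no exception: both their ends lie on components that meet the big boundary,
where `f` vanishes. -/
theorem val_sum_mul_endsAt {f : G.SmallComp → R}
    (hf : ∀ s, ¬ G.IsTorus s → f s = 0) (T : Fin N) {v w : Fin 4} (hvw : v ≠ w) :
    val (G.extendZero fun I ↦ ∑ s, f s * (G.endsAt s I : R)) T v w =
      f (G.smallComp T v) + f (G.smallComp T w) := by
  rw [val_of_ne _ T hvw]
  by_cases hE : G.IsExternal (G.edgeOf (T, ⟨(v, w), hvw⟩))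
  · rw [extendZero_of_isExternal _ hE]
    obtain ⟨p, hp, hn⟩ := (isExternal_iff _).1 hE
    have h1 : f (G.vertexComp (G.smallVertex p)) = 0 :=
      hf _ (not_isTorus_of_unglued hn (evenThird_ne_left _ _ p.2.2).symm)
    have h2 : f (G.vertexComp (G.smallVertex p.rev)) = 0 :=
      hf _ (not_isTorus_of_unglued hn (evenThird_ne_right _ _ p.2.2).symm)
    change 0 = f (G.vertexComp (G.smallVertex (T, ⟨(v, w), hvw⟩))) +
      f (G.vertexComp (G.smallVertex (TetPair.rev (T, ⟨(v, w), hvw⟩))))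
    rcases edgeOf_eq_iff.1 hp with h | h
    · rw [← smallVertex_rev_eq h, ← h, h1, h2, add_zero]
    · have h' := smallVertex_rev_eq h
      rw [TetPair.rev_rev] at h'
      rw [← h', ← h, h1, h2, add_zero]
  · rw [extendZero, dif_neg hE]
    exact sum_mul_endsAt f (I := ⟨_, hE⟩) (p := (T, ⟨(v, w), hvw⟩)) rfl

/-- A pair of opposite edges meets each vertex of the tetrahedron exactly once. -/
theorem oppSum_sum_mul_endsAt {f : G.SmallComp → R}
    (hf : ∀ s, ¬ G.IsTorus s → f s = 0) (T : Fin N) (i : Fin 3) :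
    oppSum (G.extendZero fun I ↦ ∑ s, f s * (G.endsAt s I : R)) T i =
      ∑ v, f (G.smallComp T v) := by
  fin_cases i <;> simp [oppSum, val_sum_mul_endsAt hf, Fin.sum_univ_four] <;> ring

theorem balanced_sum_mul_endsAt {f : G.SmallComp → R} (hf : ∀ s, ¬ G.IsTorus s → f s = 0) :
    Balanced (G.extendZero fun I ↦ ∑ s, f s * (G.endsAt s I : R)) := fun T i ↦ by
  rw [oppSum_sum_mul_endsAt hf, oppSum_sum_mul_endsAt hf]

theorem Balanced.two_mul_eq {n : G.InternalEdge → R} (hm : Balanced (G.extendZero n))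
    (I : G.InternalEdge) : 2 * n I = ∑ s, hm.compVal s * (G.endsAt s I : R) := by
  obtain ⟨p, hp⟩ := edgeOf_surjective I.1
  rw [sum_mul_endsAt _ hp, ← hm.two_mul_val p.1 p.2.2, val_of_ne _ _ p.2.2]
  change _ = 2 * G.extendZero n (G.edgeOf p)
  rw [hp, extendZero_coe]

/-- On a triangle $vwu$, $2f(v)$ is the sum over $vw$ and $vu$ minus the sum over $wu$. A bipartite
cancellation of signs is thus impossible. -/
theorem two_mul_eq_zero_of_sum_mul_endsAt {f : G.SmallComp → R}
    (hf : ∀ s, ¬ G.IsTorus s → f s = 0) (h : ∀ I, ∑ s, f s * (G.endsAt s I : R) = 0)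
    (s : G.SmallComp) : 2 * f s = 0 := by
  obtain ⟨⟨T, v⟩, rfl⟩ := Quot.exists_rep s
  have h1 := fun v w (hvw : v ≠ w) ↦ val_sum_mul_endsAt hf T hvw
  have h2 : ∀ v w (hvw : v ≠ w), f (G.smallComp T v) + f (G.smallComp T w) = 0 := by
    intro v w hvw
    rw [← h1 v w hvw, val_of_ne _ _ hvw, extendZero]
    split_ifs
    · rfl
    · exact h _
  have h3 : v ≠ v + 1 := by revert v; decide
  have h4 : v ≠ v + 2 := by revert v; decide
  have h5 : v + 1 ≠ v + 2 := by revert v; decide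
  change 2 * f (G.smallComp T v) = 0
  linear_combination h2 _ _ h3 + h2 _ _ h4 - h2 _ _ h5

/-- The number of ends of edges on a small torus. -/
theorem IsTorus.sum_endsAt {s : G.SmallComp} (hs : G.IsTorus s) :
    2 * ∑ I, G.endsAt s I = Nat.card {x : Fin N × Fin 4 // G.smallComp x.1 x.2 = s} := by
  rw [hs.natCard_triangles, Nat.cast_mul]
  congr 1
  simp only [endsAt]
  rw [← Nat.cast_sum, sum_natCard_eq_natCard (Q := fun V ↦ G.vertexComp V = s)]
  · rintro I V ⟨x, rfl, h, -⟩
    exact h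
  · intro V hV
    obtain ⟨x, rfl⟩ := Quot.exists_rep V
    refine ⟨⟨G.edgeOf x, ?_⟩, ⟨x, rfl, hV, rfl⟩, ?_⟩
    · intro hE
      obtain ⟨p, hp, hn⟩ := (isExternal_iff _).1 hE
      rcases edgeOf_eq_iff.1 hp with h | h
      · have h' := congrArg G.vertexComp h
        refine not_isTorus_of_unglued hn (evenThird_ne_left _ _ p.2.2).symm ?_
        exact (show G.smallComp p.1 p.2.1.1 = s from h'.trans hV) ▸ hs
      · have h' := congrArg G.vertexComp (smallVertex_rev_eq h)
        refine not_isTorus_of_unglued hn (evenThird_ne_right _ _ p.2.2).symm ?_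
        exact (show G.smallComp p.1 p.2.1.2 = s from h'.trans hV) ▸ hs
    · rintro I ⟨y, hy, -, hI⟩
      refine Subtype.ext (hI.symm.trans ?_)
      exact congrArg G.vertexEdge hy

end TetGluing


namespace TetGluing

variable {N : ℕ} {G : TetGluing N} {R : Type*} [CommRing R]

instance : DecidablePred G.IsTorus := Classical.decPred _

instance : DecidableEq G.InternalEdge := Classical.decEq _

/-! ### Linearity -/

theorem oppSum_add (m m' : G.Edge → R) (T : Fin N) (i : Fin 3) :
    oppSum (m + m') T i = oppSum m T i + oppSum m' T i := by
  have h : ∀ v w, val (m + m') T v w = val m T v w + val m' T v w := by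
    intro v w
    by_cases h : v = w <;> simp [val, h]
  fin_cases i <;> simp [oppSum, h] <;> ring

theorem oppSum_smul (c : R) (m : G.Edge → R) (T : Fin N) (i : Fin 3) :
    oppSum (c • m) T i = c * oppSum m T i := by
  have h : ∀ v w, val (c • m) T v w = c * val m T v w := by
    intro v w
    by_cases h : v = w <;> simp [val, h]
  fin_cases i <;> simp [oppSum, h] <;> ring

theorem extendZero_add (n n' : G.InternalEdge → R) :
    G.extendZero (n + n') = G.extendZero n + G.extendZero n' := by
  funext E
  by_cases h : G.IsExternal E
  · simp [extendZero, h]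
  · simp only [extendZero, Pi.add_apply, dif_neg h]
    rfl

theorem extendZero_smul (c : R) (n : G.InternalEdge → R) :
    G.extendZero (c • n) = c • G.extendZero n := by
  funext E
  by_cases h : G.IsExternal E
  · simp [extendZero, h]
  · simp only [extendZero, Pi.smul_apply, dif_neg h]
    rfl

theorem oppSum_extendZero_intCast (n : G.InternalEdge → ℤ) (T : Fin N) (i : Fin 3) :
    oppSum (G.extendZero fun I ↦ (n I : R)) T i = ((oppSum (G.extendZero (R := ℤ) n) T i : ℤ) : R) := by
  have h : ∀ v w, val (G.extendZero fun I ↦ (n I : R)) T v w = 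
      ((val (G.extendZero (R := ℤ) n) T v w : ℤ) : R) := by
    intro v w
    by_cases h : v = w
    · simp [val, h]
    · rw [val_of_ne _ _ h, val_of_ne _ _ h, extendZero, extendZero]
      split_ifs <;> simp
  fin_cases i <;> simp [oppSum, h]

variable (G R) in
/-- The linear map that sends `n` to the Hamiltonian vector field of `∑ n_I C_I`. -/
def hamMap : (G.InternalEdge → R) →ₗ[R] (Fin N → Fin 3 → R) where
  toFun n T i := oppSum (G.extendZero n) T (i + 1) - oppSum (G.extendZero n) T (i + 2)
  map_add' n n' := by
    funext T i
    simp only [extendZero_add, oppSum_add, Pi.add_apply]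
    ring
  map_smul' c n := by
    funext T i
    simp only [extendZero_smul, oppSum_smul, Pi.smul_apply, RingHom.id_apply, smul_eq_mul]
    ring

theorem hamMap_apply (n : G.InternalEdge → R) (T : Fin N) (i : Fin 3) : G.hamMap R n T i =
    oppSum (G.extendZero n) T (i + 1) - oppSum (G.extendZero n) T (i + 2) := rfl

theorem hamMap_eq_zero_iff (n : G.InternalEdge → R) :
    G.hamMap R n = 0 ↔ Balanced (G.extendZero n) := by
  constructor
  · intro h T i
    have h1 : G.hamMap R n T 1 = 0 := by rw [h]; rfl
    have h2 : G.hamMap R n T 2 = 0 := by rw [h]; rfl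
    rw [hamMap_apply, sub_eq_zero] at h1 h2
    fin_cases i
    · rfl
    · exact h2.symm
    · exact h1
  · intro h
    funext T i
    rw [hamMap_apply, h, h T (i + 2), sub_self]
    rfl

theorem balanced_intCast_iff [CharZero R] (n : G.InternalEdge → ℤ) :
    Balanced (G.extendZero fun I ↦ (n I : R)) ↔
      Balanced (G.extendZero (R := ℤ) n) := by
  simp only [Balanced, oppSum_extendZero_intCast, Int.cast_inj]

/-! ### The kernel -/

theorem sum_torus_mul (g : G.SmallComp → R) (hg : ∀ s, ¬ G.IsTorus s → g s = 0)
    (I : G.InternalEdge) : ∑ s : {s // G.IsTorus s}, g s.1 * (G.endsAt s.1 I : R) =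
      ∑ s, g s * (G.endsAt s I : R) := by
  classical
  rw [← Fintype.sum_subtype_add_sum_subtype G.IsTorus, left_eq_add]
  exact Finset.sum_eq_zero fun s _ ↦ by rw [hg _ s.2, zero_mul]

variable (G R) in
open Classical in
/-- Extension by zero of a function on the small tori. -/
def extendTorus (g : {s // G.IsTorus s} → R) (s : G.SmallComp) : R :=
  if h : G.IsTorus s then g ⟨s, h⟩ else 0

theorem extendTorus_coe (g : {s // G.IsTorus s} → R) (s : {s // G.IsTorus s}) :
    G.extendTorus R g s.1 = g s := dif_pos s.2

theorem extendTorus_of_not (g : {s // G.IsTorus s} → R) (s : G.SmallComp) (hs : ¬ G.IsTorus s) :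
    G.extendTorus R g s = 0 := dif_neg hs

theorem linearIndependent_endsAt [NoZeroDivisors R] [CharZero R] :
    LinearIndependent R fun (s : {s // G.IsTorus s}) (I : G.InternalEdge) ↦
      (G.endsAt s.1 I : R) := by
  classical
  rw [Fintype.linearIndependent_iff]
  intro g hg s
  have h := two_mul_eq_zero_of_sum_mul_endsAt (extendTorus_of_not g) (fun I ↦ by
    rw [← sum_torus_mul _ (extendTorus_of_not g)]
    simpa [extendTorus_coe] using congrFun hg I) s.1
  rw [extendTorus_coe] at h
  simpa using h

theorem ker_hamMap {K : Type*} [Field K] [CharZero K] (hG : G.IsFramed) :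
    LinearMap.ker (G.hamMap K) = Submodule.span K (Set.range
      fun (s : {s // G.IsTorus s}) (I : G.InternalEdge) ↦ (G.endsAt s.1 I : K)) := by
  classical
  apply le_antisymm
  · intro n hn
    have hm := (hamMap_eq_zero_iff n).1 hn
    rw [Submodule.mem_span_range_iff_exists_fun]
    -- Corner values are doubled by definition, hence the factor one half.
    refine ⟨fun s ↦ 2⁻¹ * hm.compVal s.1, ?_⟩
    funext I
    have h := hm.two_mul_eq I
    rw [← sum_torus_mul _ fun s ↦ hm.compVal_eq_zero hG] at h
    simp only [Finset.sum_apply, Pi.smul_apply, smul_eq_mul, mul_assoc, ← Finset.mul_sum]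
    rw [← h]
    simp
  · intro n hn
    rw [Submodule.mem_span_range_iff_exists_fun] at hn
    obtain ⟨g, rfl⟩ := hn
    rw [LinearMap.mem_ker, hamMap_eq_zero_iff]
    convert balanced_sum_mul_endsAt (extendTorus_of_not g) using 2
    funext I
    rw [← sum_torus_mul _ (extendTorus_of_not g)]
    simp [extendTorus_coe]

/-- The rank does not depend on `K`. This links multiplicative independence, a statement over `ℚ`,
with the dimension of $H$ over `ℂ`. -/
theorem finrank_range_hamMap {K : Type*} [Field K] [CharZero K] (hG : G.IsFramed) :
    Module.finrank K (LinearMap.range (G.hamMap K)) + G.numTori = Nat.card G.InternalEdge := by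
  classical
  have h := LinearMap.finrank_range_add_finrank_ker (G.hamMap K)
  rw [ker_hamMap hG, finrank_span_eq_card linearIndependent_endsAt, Module.finrank_pi] at h
  rw [numTori, Nat.card_eq_fintype_card, Nat.card_eq_fintype_card, h]

/-! ### Multiplicative relations -/

theorem prod_gluingFun_zpow (n : G.InternalEdge → ℤ) (z : PhaseSpace N) :
    ∏ I, G.gluingFun I z ^ n I = ∏ T, ∏ i, z.1 T i ^ oppSum (G.extendZero n) T i := by
  have h := congrArg Additive.toMul
    (sum_smul_sum_around n fun T i ↦ Additive.ofMul (z.1 T i))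
  simpa [gluingFun, toMul_sum, toMul_zsmul] using h

/-- Equal exponents inside each tetrahedron leave a power of $zz'z''=-1$. The sign is why balanced
vectors become relations only after doubling or a parity check. -/
theorem prod_gluingFun_zpow_of_balanced {n : G.InternalEdge → ℤ}
    (hn : Balanced (G.extendZero n)) (z : PhaseSpace N) :
    ∏ I, G.gluingFun I z ^ n I = (-1) ^ ∑ T, oppSum (G.extendZero n) T 0 := by
  rw [prod_gluingFun_zpow]
  have h : ∀ T, ∏ i, z.1 T i ^ oppSum (G.extendZero n) T i =
      (-1 : ℂˣ) ^ oppSum (G.extendZero n) T 0 := by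
    intro T
    rw [Fin.prod_univ_three, hn T 1, hn T 2, ← mul_zpow, ← mul_zpow, z.2 T]
  rw [Finset.prod_congr rfl fun T _ ↦ h T]
  generalize (Finset.univ : Finset (Fin N)) = S
  classical
  induction S using Finset.induction_on with
  | empty => simp
  | insert T S hT ih => rw [Finset.prod_insert hT, Finset.sum_insert hT, ih, zpow_add]

theorem isRelation_of_balanced {n : G.InternalEdge → ℤ} (hn : Balanced (G.extendZero n))
    (h : Even (∑ T, oppSum (G.extendZero n) T 0)) : G.IsRelation n := fun z ↦ by
  rw [prod_gluingFun_zpow_of_balanced hn, h.neg_one_zpow]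

theorem isRelation_two_mul_of_balanced {n : G.InternalEdge → ℤ} (hn : Balanced (G.extendZero n)) :
    G.IsRelation fun I ↦ 2 * n I := fun z ↦ by
  have h := prod_gluingFun_zpow_of_balanced hn z
  have h1 : ∏ I, G.gluingFun I z ^ (2 * n I) = (∏ I, G.gluingFun I z ^ n I) ^ (2 : ℤ) := by
    rw [← Finset.prod_zpow]
    exact Finset.prod_congr rfl fun I _ ↦ by rw [mul_comm, zpow_mul]
  rw [h1, h, ← zpow_mul, mul_comm, zpow_mul]
  simp

/-- A point of the phase space, with parameters `2`, `-1/2`, `1` at one tetrahedron and units of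
absolute value one at the others. -/
theorem exists_phaseSpace (T : Fin N) (i : Fin 3) : ∃ z : PhaseSpace N,
    (∀ T' ≠ T, ∀ j, ‖(z.1 T' j : ℂ)‖ = 1) ∧ ‖(z.1 T i : ℂ)‖ = 2 ∧ ‖(z.1 T (i + 1) : ℂ)‖ = 2⁻¹ ∧
      ‖(z.1 T (i + 2) : ℂ)‖ = 1 := by
  classical
  let a : ℂˣ := Units.mk0 2 two_ne_zero
  let b : Fin 3 → ℂˣ := fun j ↦ if j = i then a else if j = i + 1 then -a⁻¹ else 1
  refine ⟨⟨fun T' ↦ if T' = T then b else -1, ?_⟩, ?_, ?_, ?_, ?_⟩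
  · intro T'
    by_cases h : T' = T
    · simp only [h, if_true, b]
      fin_cases i <;> simp
    · simp [h]
  · intro T' h j
    simp [h]
  · simp [b, a]
  · have : i + 1 ≠ i := by revert i; decide
    simp [b, a]
  · have h1 : i + 2 ≠ i := by revert i; decide
    have h2 : i + 2 ≠ i + 1 := by revert i; decide
    simp [b]

/-- At the test point for `T` and `i`, the absolute value of the product is 2 to the difference of
two consecutive opposite-edge sums of `T`. -/
theorem balanced_of_isRelation {n : G.InternalEdge → ℤ} (hn : G.IsRelation n) :
    Balanced (G.extendZero n) := by
  have key : ∀ T i, oppSum (G.extendZero n) T i = oppSum (G.extendZero n) T (i + 1) := by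
    intro T i
    obtain ⟨z, h1, h2, h3, h4⟩ := exists_phaseSpace T i
    have h := hn z
    rw [prod_gluingFun_zpow] at h
    replace h := congrArg (fun u : ℂˣ ↦ ‖(u : ℂ)‖) h
    simp only [Units.coe_prod, Units.val_zpow_eq_zpow_val, norm_prod, norm_zpow, Units.val_one,
      norm_one] at h
    rw [Finset.prod_eq_single T (fun T' _ h' ↦ Finset.prod_eq_one fun j _ ↦ by
      rw [h1 T' h' j, one_zpow]) (by simp)] at h
    have h5 : ∀ f : Fin 3 → ℝ, ∏ j, f j = f i * f (i + 1) * f (i + 2) := by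
      intro f
      rw [Fin.prod_univ_three]
      fin_cases i <;> simp <;> ring
    rw [h5, h2, h3, h4, one_zpow, mul_one, inv_zpow, ← zpow_neg, ← zpow_add₀ two_ne_zero] at h
    have h6 := (zpow_eq_one_iff_right₀ (by norm_num : (0 : ℝ) ≤ 2) (by norm_num)).1 h
    omega
  intro T i
  fin_cases i
  · rfl
  · exact (key T 0).symm
  · exact ((key T 0).trans (key T 1)).symm

theorem isRelation_endsAt {s : G.SmallComp} (hs : G.IsTorus s) : G.IsRelation (G.endsAt s) := by
  classical
  have hf : ∀ s', ¬ G.IsTorus s' → (Pi.single s 1 : G.SmallComp → ℤ) s' = 0 := by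
    intro s' h
    exact Pi.single_eq_of_ne (fun h' : s' = s ↦ h (by rw [h']; exact hs)) 1
  have h : G.endsAt s = fun I ↦ ∑ s', (Pi.single s 1 : G.SmallComp → ℤ) s' *
      (Int.cast (G.endsAt s' I) : ℤ) := by
    funext I
    simp [Pi.single_apply]
  rw [h]
  refine isRelation_of_balanced (balanced_sum_mul_endsAt hf) ?_
  simp only [oppSum_sum_mul_endsAt hf]
  -- The exponent of $-1$ is the number of triangles of the torus, which is even.
  have h2 : ∑ T, ∑ v, (Pi.single s 1 : G.SmallComp → ℤ) (G.smallComp T v) =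
      Nat.card {x : Fin N × Fin 4 // G.smallComp x.1 x.2 = s} := by
    rw [Nat.card_eq_fintype_card, Fintype.card_subtype, Finset.card_filter, Fintype.sum_prod_type]
    simp [Pi.single_apply]
  rw [h2, hs.natCard_triangles]
  simp

theorem IsRelation.two_smul_mem (hG : G.IsFramed) {n : G.InternalEdge → ℤ} (hn : G.IsRelation n) :
    (2 : ℤ) • n ∈ Submodule.span ℤ (Set.range fun s : {s // G.IsTorus s} ↦ G.endsAt s.1) := by
  have hm := balanced_of_isRelation hn
  have : (2 : ℤ) • n = ∑ s : {s // G.IsTorus s}, hm.compVal s.1 • G.endsAt s.1 := by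
    funext I
    have h := hm.two_mul_eq I
    rw [← sum_torus_mul _ fun s ↦ hm.compVal_eq_zero hG] at h
    simpa using h
  rw [this]
  exact Submodule.sum_mem _ fun s _ ↦ Submodule.smul_mem _ _ (Submodule.subset_span ⟨s, rfl⟩)

/-- Denominators are cleared by passing from `ℚ` to `ℤ`. A linear relation among the fields makes
the product a sign, so its square is a multiplicative relation; conversely relations are balanced.
-/
theorem mulIndep_iff (S : Finset G.InternalEdge) : G.MulIndep S ↔
    LinearIndependent ℚ fun I : S ↦ G.hamMap ℚ (Pi.single I.1 1) := by
  classical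
  rw [← LinearIndependent.iff_fractionRing ℤ ℚ]
  have key : ∀ n : G.InternalEdge → ℤ, ∑ I ∈ S, n I • G.hamMap ℚ (Pi.single I 1) = 0 ↔
      Balanced (G.extendZero fun I ↦ if I ∈ S then n I else 0) := by
    intro n
    rw [← balanced_intCast_iff (R := ℚ), ← hamMap_eq_zero_iff]
    have : (fun I ↦ ((if I ∈ S then n I else 0 : ℤ) : ℚ)) =
        ∑ I ∈ S, n I • (Pi.single I 1 : G.InternalEdge → ℚ) := by
      funext J
      simp [Finset.sum_apply, Pi.single_apply]
    rw [this, map_sum]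
    simp only [map_zsmul]
  have key2 : ∀ (n : G.InternalEdge → ℤ) (z : PhaseSpace N), ∏ I ∈ S, G.gluingFun I z ^ n I =
      ∏ I, G.gluingFun I z ^ (if I ∈ S then n I else 0) := by
    intro n z
    simp
  have key3 := linearIndepOn_finset_iff (R := ℤ) (s := S)
    (v := fun I ↦ G.hamMap ℚ (Pi.single I 1))
  refine Iff.trans ?_ key3.symm
  constructor
  · intro h n hn I hI
    have h1 := isRelation_two_mul_of_balanced ((key n).1 hn)
    have h2 := h (fun I ↦ 2 * n I) (fun z ↦ by
      rw [key2, ← h1 z]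
      exact Finset.prod_congr rfl fun J _ ↦ by by_cases hJ : J ∈ S <;> simp [hJ]) I hI
    simpa using h2
  · intro h n hn
    exact h n ((key n).2 (balanced_of_isRelation fun z ↦ by rw [← key2]; exact hn z))

theorem span_range_hamMap_single (K : Type*) [Field K] :
    Submodule.span K (Set.range fun I : G.InternalEdge ↦ G.hamMap K (Pi.single I 1)) =
      LinearMap.range (G.hamMap K) := by
  rw [LinearMap.range_eq_map, ← (Pi.basisFun K G.InternalEdge).span_eq, Submodule.map_span,
    ← Set.range_comp]
  congr 2

theorem exists_mulIndep : ∃ S : Finset G.InternalEdge, G.MulIndep S ∧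
    S.card = Module.finrank ℚ (LinearMap.range (G.hamMap ℚ)) := by
  classical
  obtain ⟨κ, a, ha, h1, h2⟩ := exists_linearIndependent' ℚ
    fun I : G.InternalEdge ↦ G.hamMap ℚ (Pi.single I 1)
  have : Finite κ := Finite.of_injective a ha
  have := Fintype.ofFinite κ
  refine ⟨Finset.univ.image a, ?_, ?_⟩
  · rw [mulIndep_iff]
    have h3 : LinearIndepOn ℚ (fun I : G.InternalEdge ↦ G.hamMap ℚ (Pi.single I 1))
      (Set.range a) := (linearIndepOn_range_iff ha _).2 h2
    have h4 : ((Finset.univ.image a : Finset G.InternalEdge) : Set G.InternalEdge) =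
      Set.range a := by simp
    rw [← h4] at h3
    exact h3
  · rw [Finset.card_image_of_injective _ ha, ← span_range_hamMap_single, ← h1,
      finrank_span_eq_card h2, Finset.card_univ]

theorem MulIndep.card_le {S : Finset G.InternalEdge} (hS : G.MulIndep S) :
    S.card ≤ Module.finrank ℚ (LinearMap.range (G.hamMap ℚ)) := by
  classical
  rw [mulIndep_iff] at hS
  have h := finrank_span_eq_card hS
  rw [Fintype.card_coe] at h
  rw [← h, ← span_range_hamMap_single]
  refine Submodule.finrank_mono (Submodule.span_mono ?_)
  rintro _ ⟨I, rfl⟩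
  exact ⟨I.1, rfl⟩

end TetGluing


namespace TetGluing

variable {N : ℕ} {G : TetGluing N}

/-! ### Solving the gluing equations -/

theorem sum_mul_gluingSum (n : G.InternalEdge → ℂ) (Z : Fin N → Fin 3 → ℂ) :
    ∑ I, n I * G.gluingSum I Z = ∑ T, ∑ i, oppSum (G.extendZero n) T i * Z T i := by
  simpa [gluingSum] using sum_smul_sum_around n Z

variable (G) in
/-- The left hand sides of the equations of the tetrahedra and of the gluing equations. -/
def equations : (Fin N → Fin 3 → ℂ) →ₗ[ℂ] (Fin N ⊕ G.InternalEdge → ℂ) where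
  toFun Z := Sum.elim (fun T ↦ ∑ i, Z T i) fun I ↦ G.gluingSum I Z
  map_add' Z Z' := by
    funext x
    rcases x with T | I <;> simp [gluingSum, Finset.sum_add_distrib]
  map_smul' c Z := by
    funext x
    rcases x with T | I <;> simp [gluingSum, Finset.mul_sum]

/-- With $f$ the component function, twice the left sum weights triangles by $f$ and $2\sum n_I$
weights edge ends by $f$. On a torus there are two triangles per end; elsewhere $f=0$. -/
theorem Balanced.sum_oppSum (hG : G.IsFramed) {n : G.InternalEdge → ℂ}
    (hm : Balanced (G.extendZero n)) : ∑ T, oppSum (G.extendZero n) T 0 = 2 * ∑ I, n I := by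
  have h1 : ∀ T, 2 * oppSum (G.extendZero n) T 0 = ∑ v, hm.compVal (G.smallComp T v) := by
    intro T
    have h01 := hm.two_mul_val T (show (0 : Fin 4) ≠ 1 by decide)
    have h23 := hm.two_mul_val T (show (2 : Fin 4) ≠ 3 by decide)
    rw [Fin.sum_univ_four]
    simp only [oppSum, Matrix.cons_val_zero]
    linear_combination h01 + h23
  have h2 : 2 * ∑ T, oppSum (G.extendZero n) T 0 = ∑ s, hm.compVal s *
      (Nat.card {x : Fin N × Fin 4 // G.smallComp x.1 x.2 = s} : ℂ) := by
    classical
    rw [Finset.mul_sum, Finset.sum_congr rfl fun T _ ↦ h1 T]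
    rw [← Fintype.sum_prod_type (f := fun x : Fin N × Fin 4 ↦ hm.compVal (G.smallComp x.1 x.2)),
      ← Finset.sum_fiberwise (g := fun x : Fin N × Fin 4 ↦ G.smallComp x.1 x.2)]
    refine Finset.sum_congr rfl fun s _ ↦ ?_
    rw [Finset.sum_congr rfl (g := fun _ ↦ hm.compVal s), Finset.sum_const, Nat.card_eq_fintype_card,
      Fintype.card_subtype, nsmul_eq_mul, mul_comm]
    intro x hx
    rw [(Finset.mem_filter.1 hx).2]
  have h3 : 2 * ∑ I, n I = ∑ s, hm.compVal s * ((∑ I, G.endsAt s I : ℤ) : ℂ) := by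
    rw [Finset.mul_sum, Finset.sum_congr rfl fun I _ ↦ hm.two_mul_eq I, Finset.sum_comm]
    simp [Finset.mul_sum]
  have h4 : ∑ s, hm.compVal s * (Nat.card {x : Fin N × Fin 4 // G.smallComp x.1 x.2 = s} : ℂ) =
      2 * ∑ s, hm.compVal s * ((∑ I, G.endsAt s I : ℤ) : ℂ) := by
    rw [Finset.mul_sum]
    refine Finset.sum_congr rfl fun s _ ↦ ?_
    by_cases hs : G.IsTorus s
    · have h5 : (2 * (∑ I, G.endsAt s I : ℤ) : ℂ) =
          (Nat.card {x : Fin N × Fin 4 // G.smallComp x.1 x.2 = s} : ℂ) := by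
        exact_mod_cast hs.sum_endsAt
      rw [← h5]
      ring
    · rw [hm.compVal_eq_zero hG hs]
      ring
  linear_combination (h2 + h4 - 2 * h3) / 2

/-- Fredholm alternative: a functional that kills all left-hand sides has balanced coefficients `n`
on the gluing equations, and `Balanced.sum_oppSum` says precisely that it kills the right-hand sides
too. -/
theorem exists_logGluingFun_eq_zero (hG : G.IsFramed) :
    ∃ Z ∈ logPhaseSpace N, ∀ I, G.logGluingFun I Z = 0 := by
  let b : Fin N ⊕ G.InternalEdge → ℂ :=
    Sum.elim (fun _ ↦ Complex.I * Real.pi) fun _ ↦ 2 * Real.pi * Complex.I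
  have hb : b ∈ LinearMap.range G.equations := by
    by_contra hb
    obtain ⟨φ, hφ, hker⟩ := Submodule.exists_le_ker_of_notMem hb
    apply hφ
    let l : Fin N → ℂ := fun T ↦ φ (Pi.single (Sum.inl T) 1)
    let n : G.InternalEdge → ℂ := fun I ↦ φ (Pi.single (Sum.inr I) 1)
    have h1 : ∀ x, φ x = ∑ T, l T * x (Sum.inl T) + ∑ I, n I * x (Sum.inr I) := by
      intro x
      conv_lhs => rw [← Finset.univ_sum_single x]
      rw [map_sum, Fintype.sum_sum_type]
      have h2 : ∀ j, φ (Pi.single j (x j)) = φ (Pi.single j 1) * x j := by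
        intro j
        rw [mul_comm, ← smul_eq_mul, ← map_smul, ← Pi.single_smul, smul_eq_mul, mul_one]
      simp only [h2, l, n]
    have h2 : ∀ Z : Fin N → Fin 3 → ℂ,
        ∑ T, ∑ i, (l T + oppSum (G.extendZero n) T i) * Z T i = 0 := by
      intro Z
      have h := hker ⟨Z, rfl⟩
      rw [LinearMap.mem_ker, h1] at h
      simp only [equations, LinearMap.coe_mk, AddHom.coe_mk, Sum.elim_inl, Sum.elim_inr] at h
      rw [sum_mul_gluingSum, ← Finset.sum_add_distrib] at h
      rw [← h]
      refine Finset.sum_congr rfl fun T _ ↦ ?_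
      rw [Finset.mul_sum, ← Finset.sum_add_distrib]
      exact Finset.sum_congr rfl fun i _ ↦ by ring
    have h3 : ∀ T i, oppSum (G.extendZero n) T i = - l T := by
      intro T i
      have h := h2 (Pi.single T (Pi.single i 1))
      rw [Finset.sum_eq_single T (fun T' _ h' ↦ by simp [h']) (by simp),
        Finset.sum_eq_single i (fun i' _ h' ↦ by simp [h']) (by simp)] at h
      simp at h
      linear_combination h
    have hm : Balanced (G.extendZero n) := fun T i ↦ by rw [h3, h3]
    have h4 := hm.sum_oppSum hG
    simp only [h3, Finset.sum_neg_distrib] at h4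
    rw [h1]
    simp only [b, Sum.elim_inl, Sum.elim_inr, ← Finset.sum_mul]
    linear_combination (-Complex.I * Real.pi) * h4
  obtain ⟨Z, hZ⟩ := hb
  refine ⟨Z, fun T ↦ ?_, fun I ↦ ?_⟩
  · have h := congrFun hZ (Sum.inl T)
    simpa [equations, b, Fin.sum_univ_three] using h
  · have h := congrFun hZ (Sum.inr I)
    simp only [equations, b, LinearMap.coe_mk, AddHom.coe_mk, Sum.elim_inr] at h
    rw [logGluingFun, h, sub_self]

/-! ### The symplectic reduction -/

theorem hamMap_mem_logTangent (n : G.InternalEdge → ℂ) : G.hamMap ℂ n ∈ logTangent N := by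
  intro T
  simp [hamMap_apply]

/-- Expanding, the coefficient of the third sum is $-(v_0+v_1)$, which is $v_2$ on the tangent
space. -/
theorem logSymplectic_hamMap (n : G.InternalEdge → ℂ) {v : Fin N → Fin 3 → ℂ}
    (hv : v ∈ logTangent N) :
    logSymplectic (G.hamMap ℂ n) v = ∑ I, n I * G.gluingSum I v := by
  rw [sum_mul_gluingSum]
  refine Finset.sum_congr rfl fun T _ ↦ ?_
  have h := hv T
  simp only [hamMap_apply, Fin.sum_univ_three]
  simp
  linear_combination (-oppSum (G.extendZero n) T 2) * h

theorem logSymplectic_hamMap_single (I : G.InternalEdge) {v : Fin N → Fin 3 → ℂ}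
    (hv : v ∈ logTangent N) :
    logSymplectic (G.hamMap ℂ (Pi.single I 1)) v = G.gluingSum I v := by
  rw [logSymplectic_hamMap _ hv, Finset.sum_eq_single I (fun J _ h ↦ by simp [h]) (by simp)]
  simp

theorem isHamiltonian_hamMap (I : G.InternalEdge) :
    G.IsHamiltonian I (G.hamMap ℂ (Pi.single I 1)) :=
  ⟨hamMap_mem_logTangent _, fun _ hv ↦ logSymplectic_hamMap_single I hv⟩

variable (N) in
/-- The symplectic form on the tangent space of the logarithmic phase space. -/
def symplecticForm : LinearMap.BilinForm ℂ (logTangent N) :=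
  LinearMap.mk₂ ℂ (fun u v ↦ logSymplectic u.1 v.1)
    (fun u u' v ↦ by
      simp only [logSymplectic, ← Finset.sum_add_distrib]
      refine Finset.sum_congr rfl fun T _ ↦ ?_
      simp
      ring)
    (fun c u v ↦ by
      simp only [logSymplectic, smul_eq_mul, Finset.mul_sum]
      refine Finset.sum_congr rfl fun T _ ↦ ?_
      simp
      ring)
    (fun u v v' ↦ by
      simp only [logSymplectic, ← Finset.sum_add_distrib]
      refine Finset.sum_congr rfl fun T _ ↦ ?_
      simp
      ring)
    (fun c u v ↦ by
      simp only [logSymplectic, smul_eq_mul, Finset.mul_sum]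
      refine Finset.sum_congr rfl fun T _ ↦ ?_
      simp
      ring)

theorem symplecticForm_apply (u v : logTangent N) :
    symplecticForm N u v = logSymplectic u.1 v.1 := rfl

theorem logSymplectic_comm (u v : Fin N → Fin 3 → ℂ) :
    logSymplectic u v = - logSymplectic v u := by
  rw [logSymplectic, logSymplectic, ← Finset.sum_neg_distrib]
  exact Finset.sum_congr rfl fun T _ ↦ by ring

theorem symplecticForm_isRefl : (symplecticForm N).IsRefl := by
  intro u v h
  rw [symplecticForm_apply] at h ⊢
  rw [logSymplectic_comm, h, neg_zero]

theorem eq_zero_of_logSymplectic {u : Fin N → Fin 3 → ℂ} (hu : u ∈ logTangent N)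
    (h : ∀ v ∈ logTangent N, logSymplectic u v = 0) : u = 0 := by
  classical
  funext T
  have key : ∀ a b c : ℂ, a + b + c = 0 → u T 0 * b - u T 1 * a = 0 := by
    intro a b c habc
    have h1 := h (Pi.single T ![a, b, c]) (by
      intro T'
      by_cases hT : T' = T
      · subst hT
        simpa using habc
      · simp [hT])
    rw [logSymplectic, Finset.sum_eq_single T (fun T' _ h' ↦ by simp [h']) (by simp)] at h1
    simpa using h1
  have h0 : u T 0 = 0 := by linear_combination key 0 1 (-1) (by ring)
  have h1 : u T 1 = 0 := by linear_combination -key 1 0 (-1) (by ring)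
  have h2 : u T 2 = 0 := by linear_combination hu T - h0 - h1
  funext i
  fin_cases i
  · exact h0
  · exact h1
  · exact h2

theorem symplecticForm_nondegenerate : (symplecticForm N).Nondegenerate := by
  have h : ∀ u : logTangent N, (∀ v, symplecticForm N u v = 0) → u = 0 := fun u hu ↦
    Subtype.ext (eq_zero_of_logSymplectic u.2 fun v hv ↦ hu ⟨v, hv⟩)
  exact ⟨h, fun u hu ↦ h u fun v ↦ symplecticForm_isRefl _ _ (hu v)⟩

/-- Nondegeneracy makes the Hamiltonian field unique, so the span of all such fields is exactly the
range of `hamMap`. -/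
theorem isHamiltonian_iff (I : G.InternalEdge) (X : Fin N → Fin 3 → ℂ) :
    G.IsHamiltonian I X ↔ X = G.hamMap ℂ (Pi.single I 1) := by
  constructor
  · rintro ⟨hX, h⟩
    have h1 : X - G.hamMap ℂ (Pi.single I 1) ∈ logTangent N :=
      sub_mem hX (hamMap_mem_logTangent _)
    refine sub_eq_zero.1 (eq_zero_of_logSymplectic h1 fun v hv ↦ ?_)
    have h2 : logSymplectic (X - G.hamMap ℂ (Pi.single I 1)) v =
        logSymplectic X v - logSymplectic (G.hamMap ℂ (Pi.single I 1)) v := by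
      simp only [logSymplectic, ← Finset.sum_sub_distrib]
      refine Finset.sum_congr rfl fun T _ ↦ ?_
      simp
      ring
    rw [h2, h v hv, logSymplectic_hamMap_single I hv, sub_self]
  · rintro rfl
    exact isHamiltonian_hamMap I

theorem hamiltonianSpan_eq : G.hamiltonianSpan = LinearMap.range (G.hamMap ℂ) := by
  rw [hamiltonianSpan, ← span_range_hamMap_single]
  congr 1
  ext X
  simp only [isHamiltonian_iff, Set.mem_ofPred_eq, Set.mem_range, eq_comm]

theorem hamiltonianSpan_le_logTangent : G.hamiltonianSpan ≤ logTangent N := by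
  rw [hamiltonianSpan_eq]
  rintro _ ⟨n, rfl⟩
  exact hamMap_mem_logTangent n

theorem levelTangent_le_logTangent : G.levelTangent ≤ logTangent N := fun _ h ↦ h.1

/-- This is the Poisson commutativity of the $C_I$: each is constant along the flows of the others.
-/
theorem hamiltonianSpan_le_levelTangent : G.hamiltonianSpan ≤ G.levelTangent := by
  rw [hamiltonianSpan_eq]
  rintro _ ⟨n, rfl⟩
  refine ⟨hamMap_mem_logTangent n, fun I ↦ ?_⟩
  have h := sum_mul_gluingSum (Pi.single I 1) (G.hamMap ℂ n)
  rw [Finset.sum_eq_single I (fun J _ h ↦ by simp [h]) (by simp), Pi.single_eq_same, one_mul] at h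
  rw [h]
  exact sum_oppSum_mul_eq_zero n (Pi.single I 1)

theorem levelTangent_submoduleOf : G.levelTangent.submoduleOf (logTangent N) =
    (symplecticForm N).orthogonal (G.hamiltonianSpan.submoduleOf (logTangent N)) := by
  ext u
  rw [LinearMap.BilinForm.mem_orthogonal_iff]
  constructor
  · intro hu X hX
    have hX' : X.1 ∈ G.hamiltonianSpan := hX
    rw [hamiltonianSpan_eq] at hX'
    obtain ⟨n, hn⟩ := hX'
    have hu' : u.1 ∈ G.levelTangent := hu
    change logSymplectic X.1 u.1 = 0
    rw [← hn, logSymplectic_hamMap n u.2]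
    exact Finset.sum_eq_zero fun I _ ↦ by rw [hu'.2 I, mul_zero]
  · intro hu
    refine ⟨u.2, fun I ↦ ?_⟩
    have h := hu ⟨G.hamMap ℂ (Pi.single I 1), hamMap_mem_logTangent _⟩
      (show G.hamMap ℂ (Pi.single I 1) ∈ G.hamiltonianSpan by
        rw [hamiltonianSpan_eq]
        exact ⟨_, rfl⟩)
    exact (logSymplectic_hamMap_single I u.2).symm.trans h

/-- The level tangent space is $H^\perp$, and $H^{\perp\perp}=H$ by nondegeneracy. -/
theorem forall_logSymplectic_eq_zero_iff {u : Fin N → Fin 3 → ℂ} (hu : u ∈ G.levelTangent) :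
    (∀ v ∈ G.levelTangent, logSymplectic u v = 0) ↔ u ∈ G.hamiltonianSpan := by
  have h := LinearMap.BilinForm.orthogonal_orthogonal symplecticForm_nondegenerate
    symplecticForm_isRefl (G.hamiltonianSpan.submoduleOf (logTangent N))
  rw [← levelTangent_submoduleOf] at h
  have h1 : u ∈ G.hamiltonianSpan ↔
      (⟨u, hu.1⟩ : logTangent N) ∈ G.hamiltonianSpan.submoduleOf (logTangent N) := Iff.rfl
  rw [h1, ← h, LinearMap.BilinForm.mem_orthogonal_iff]
  constructor
  · intro h2 v hv
    change logSymplectic v.1 u = 0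
    rw [logSymplectic_comm, h2 v.1 hv, neg_zero]
  · intro h2 v hv
    rw [logSymplectic_comm]
    exact neg_eq_zero.2 (h2 ⟨v, hv.1⟩ hv)

theorem finrank_logTangent : Module.finrank ℂ (logTangent N) = 2 * N := by
  let e : logTangent N ≃ₗ[ℂ] (Fin N → Fin 2 → ℂ) :=
    { toFun := fun u T ↦ ![u.1 T 0, u.1 T 1]
      invFun := fun u ↦ ⟨fun T ↦ ![u T 0, u T 1, -u T 0 - u T 1], fun T ↦ by simp⟩
      map_add' := fun u v ↦ by
        funext T i
        fin_cases i <;> simp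
      map_smul' := fun c u ↦ by
        funext T i
        fin_cases i <;> simp
      left_inv := fun u ↦ by
        refine Subtype.ext (funext fun T ↦ funext fun i ↦ ?_)
        have h := u.2 T
        fin_cases i
        · rfl
        · rfl
        · simp
          linear_combination -h
      right_inv := fun u ↦ by
        funext T i
        fin_cases i <;> simp }
  rw [e.finrank_eq]
  simp [Module.finrank_pi_fintype, mul_comm]

theorem finrank_levelTangent :
    Module.finrank ℂ G.levelTangent + Module.finrank ℂ G.hamiltonianSpan = 2 * N := by
  have h := LinearMap.BilinForm.finrank_add_finrank_orthogonal' (B := symplecticForm N)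
    (G.hamiltonianSpan.submoduleOf (logTangent N))
  rw [symplecticForm_nondegenerate.ker_eq_bot, inf_bot_eq, finrank_bot, add_zero,
    ← levelTangent_submoduleOf, finrank_logTangent,
    (Submodule.submoduleOfEquivOfLe hamiltonianSpan_le_logTangent).finrank_eq,
    (Submodule.submoduleOfEquivOfLe levelTangent_le_logTangent).finrank_eq] at h
  rw [add_comm, h]

theorem finrank_reduction : Module.finrank ℂ
    (G.levelTangent ⧸ G.hamiltonianSpan.submoduleOf G.levelTangent) +
      2 * Module.finrank ℂ G.hamiltonianSpan = 2 * N := by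
  have h := Submodule.finrank_quotient_add_finrank (G.hamiltonianSpan.submoduleOf G.levelTangent)
  rw [(Submodule.submoduleOfEquivOfLe hamiltonianSpan_le_levelTangent).finrank_eq] at h
  have h1 := finrank_levelTangent (G := G)
  omega

end TetGluing

end

theorem mainTheorem2 (N : ℕ) (G : TetGluing N) (hG : G.IsFramed) :
    -- the number of internal edges
    (Nat.card G.InternalEdge : ℚ) = N - G.bigHalfDim - G.numAnnuli ∧
    ∃ r : ℕ, (r : ℚ) = N - G.bigHalfDim - G.numAnnuli - G.numTori ∧
      -- the number of multiplicatively independent gluing functions is exactly `r`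
      (∃ S : Finset G.InternalEdge, G.MulIndep S ∧ S.card = r) ∧
      (∀ S : Finset G.InternalEdge, G.MulIndep S → S.card ≤ r) ∧
      -- one relation for each small torus, these relations are independent, and no others
      (∀ s, G.IsTorus s → G.IsRelation (G.endsAt s)) ∧
      LinearIndependent ℤ (fun s : {s // G.IsTorus s} ↦ G.endsAt s.1) ∧
      (∀ n : G.InternalEdge → ℤ, G.IsRelation n → ∃ k : ℤ, k ≠ 0 ∧
        k • n ∈ Submodule.span ℤ (Set.range fun s : {s // G.IsTorus s} ↦ G.endsAt s.1)) ∧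
      -- the logarithmic symplectic reduction with respect to the moment maps `C_I`
      (∃ Z ∈ logPhaseSpace N, ∀ I, G.logGluingFun I Z = 0) ∧
      (∀ I, ∃ X, G.IsHamiltonian I X) ∧
      Module.finrank ℂ G.hamiltonianSpan = r ∧
      G.hamiltonianSpan ≤ G.levelTangent ∧
      (∀ u ∈ G.levelTangent,
        (∀ v ∈ G.levelTangent, logSymplectic u v = 0) ↔ u ∈ G.hamiltonianSpan) ∧
      (Module.finrank ℂ
          (G.levelTangent ⧸ G.hamiltonianSpan.submoduleOf G.levelTangent) : ℚ) =
        2 * G.bigHalfDim + 2 * G.numAnnuli + 2 * G.numTori := by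
  refine ⟨hG.natCard_internalEdge, Module.finrank ℚ (LinearMap.range (G.hamMap ℚ)), ?_,
    TetGluing.exists_mulIndep, fun S hS ↦ hS.card_le,
    fun s hs ↦ TetGluing.isRelation_endsAt hs, ?_,
    fun n hn ↦ ⟨2, two_ne_zero, hn.two_smul_mem hG⟩,
    TetGluing.exists_logGluingFun_eq_zero hG,
    fun I ↦ ⟨_, TetGluing.isHamiltonian_hamMap I⟩, ?_,
    TetGluing.hamiltonianSpan_le_levelTangent,
    fun u hu ↦ TetGluing.forall_logSymplectic_eq_zero_iff hu, ?_⟩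
  · have h1 := hG.natCard_internalEdge
    have h2 := TetGluing.finrank_range_hamMap (K := ℚ) hG
    qify at h2
    linarith
  · simpa using TetGluing.linearIndependent_endsAt (G := G) (R := ℤ)
  -- The ranks over `ℚ` and `ℂ` agree, both being the number of internal edges minus $t$.
  · have h1 := TetGluing.finrank_range_hamMap (K := ℚ) hG
    have h2 := TetGluing.finrank_range_hamMap (K := ℂ) hG
    rw [TetGluing.hamiltonianSpan_eq]
    omega
  · have h1 := hG.natCard_internalEdge
    have h2 := TetGluing.finrank_range_hamMap (K := ℂ) hG
    have h3 := TetGluing.finrank_reduction (G := G)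
    rw [TetGluing.hamiltonianSpan_eq] at h3 ⊢
    qify at h2 h3
    linarith
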